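/- Put $\epsilon_1=1$, $\epsilon_2=\epsilon_3=-1$ and take indices modulo 3. Let $(M,\sigma,g)$ be a paraquaternionic K\"ahler manifold: $(M,g)$ is a semi-Riemannian manifold with Levi-Civita connection $\overline\nabla$; $\sigma$ is a rank-3 subbundle of $\mathrm{End}(TM)$ which has, near each point, a smooth basis $J_1,J_2,J_3$ with $J_\alpha^2=-\epsilon_\alpha\mathrm{Id}$ and $J_\alpha J_{\alpha+1}=-J_{\alpha+1}J_\alpha=\epsilon_{\alpha+2}J_{\alpha+2}$ (a canonical local basis); $g(J_\alpha X,J_\alpha Y)=\epsilon_\alpha g(X,Y)$ for every canonical local basis; and $\sigma$ is parallel with respect to $\overline\nabla$. Let $N$ be a paraquaternionic CR-submanifold of $M$: an immersed submanifold whose induced metric $g|_{TN}$ is nondegenerate, together with a smooth distribution $\mathcal D\subseteq TN$ on which $g$ is nondegenerate, such that for every canonical local basis $J_\alpha\mathcal D_x=\mathcal D_x$ and $J_\alpha\mathcal D_x^\perp\subseteq T_xN^\perp$, where $\mathcal D^\perp$ is the orthogonal complement of $\mathcal D$ in $TN$ and $TN^\perp$ is the normal bundle. Let $\nabla$ be the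 Levi-Civita connection of the induced metric. For tangent vector fields $X,Y$ of $N$ let $B(X,Y)$ be the normal part of $\overline\nabla_XY$ (the second fundamental form), and for a normal field $\xi$ let $-A_\xi X$ be the tangential part of $\overline\nabla_X\xi$ (so $A_\xi$ is the shape operator). Let $\nu^\perp_x=J_1\mathcal D_x^\perp+J_2\mathcal D_x^\perp+J_3\mathcal D_x^\perp$, which does not depend on the canonical local basis, and let $\nu$ be the orthogonal complement of $\nu^\perp$ in $TN^\perp$. Then $\mathcal D^\perp$ is integrable (a smooth distribution closed under the Lie bracket), hence defines a foliation $\mathfrak F^\perp$ of $N$, the canonical totally real foliation. Call $\mathfrak F^\perp$ totally geodesic if the second fundamental form of its leaves in $N$ vanishes, i.e. $\nabla_XZ\in\Gamma(\mathcal D^\perp)$ for all $X,Z\in\Gamma(\mathcal D^\perp)$. The following are equivalent: (i) $\mathfrak F^\perp$ is totally geodesic; (ii) $B(X,Y)\in\Gamma(\nu)$ for all $X\in\Gamma(\mathcal D)$, $Y\in\Gamma(\mathcal D^\perp)$; (iii) $A_\xi X\in\Gamma(\mathcal D^\perp)$ for all $X\in\Gamma(\mathcal D^\perp)$, $\xi\in\Gamma(\nu^\perp)$;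 (iv) $A_\xi Y\in\Gamma(\mathcal D)$ for all $Y\in\Gamma(\mathcal D)$, $\xi\in\Gamma(\nu^\perp)$. Moreover, call $N$ mixed geodesic if $B(X,Y)=0$ for all $X\in\Gamma(\mathcal D)$, $Y\in\Gamma(\mathcal D^\perp)$. If $N$ is mixed geodesic, then $\mathfrak F^\perp$ is totally geodesic. If $\nu=0$, then $\mathfrak F^\perp$ is totally geodesic if and only if $N$ is mixed geodesic. -/

import Mathlib

open Bundle Manifold Set
open scoped ContDiff Topology

noncomputable section

/-! Manifolds are Hausdorff, smooth, without boundary, and modelled on a finite-dimensional real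
normed space. A tensor field is a family indexed by the points, its smoothness is stated in the
corresponding Mathlib bundle. -/

/-! ### Linear algebra -/

/-- The vector `z` with `b z w = ℓ w` for all `w`. It exists and is unique when `b` is
nondegenerate, see `sharp_spec`. -/
def sharp {V : Type*} [AddCommGroup V] [Module ℝ V] [TopologicalSpace V]
    (b : V →L[ℝ] V →L[ℝ] ℝ) (ℓ : V → ℝ) : V :=
  Classical.epsilon fun z => ∀ w, b z w = ℓ w

/-- The `b`-orthogonal complement of `W`. -/
def orthCompl {V : Type*} [AddCommGroup V] [Module ℝ V] [TopologicalSpace V]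
    (b : V →L[ℝ] V →L[ℝ] ℝ) (W : Submodule ℝ V) : Submodule ℝ V where
  carrier := {u | ∀ w ∈ W, b w u = 0}
  add_mem' hu hv w hw := by simp [hu w hw, hv w hw]
  zero_mem' w _ := by simp
  smul_mem' c u hu w hw := by simp [hu w hw]

theorem sharp_spec {V : Type*} [AddCommGroup V] [Module ℝ V] [TopologicalSpace V]
    [FiniteDimensional ℝ V] (b : V →L[ℝ] V →L[ℝ] ℝ)
    (hb : ∀ u, (∀ v, b u v = 0) → u = 0) (ℓ : V →ₗ[ℝ] ℝ) (w : V) :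
    b (sharp b ℓ) w = ℓ w := by
  let B : V →ₗ[ℝ] Module.Dual ℝ V :=
    { toFun := fun u => (b u : V →ₗ[ℝ] ℝ)
      map_add' := fun u v => by ext; simp
      map_smul' := fun c u => by ext; simp }
  have hinj : Function.Injective B := by
    rw [injective_iff_map_eq_zero]
    intro u hu
    exact hb u fun v => congrArg (fun φ : Module.Dual ℝ V => φ v) hu
  have hsurj : Function.Surjective B :=
    (LinearMap.injective_iff_surjective_of_finrank_eq_finrank
      (Subspace.dual_finrank_eq (K := ℝ) (V := V)).symm).1 hinj
  obtain ⟨z, hz⟩ := hsurj ℓ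
  have hex : ∃ z, ∀ w, b z w = ℓ w :=
    ⟨z, fun w => congrArg (fun φ : Module.Dual ℝ V => φ w) hz⟩
  exact Classical.epsilon_spec hex w

/-! ### Semi-Riemannian metrics and the Levi-Civita connection -/

section Metric

variable {E : Type*} [NormedAddCommGroup E] [NormedSpace ℝ E]
  {M : Type*} [TopologicalSpace M] [ChartedSpace E M] [IsManifold 𝓘(ℝ, E) ∞ M]
  {F : Type*} [NormedAddCommGroup F] [NormedSpace ℝ F]
  {N : Type*} [TopologicalSpace N] [ChartedSpace F N] [IsManifold 𝓘(ℝ, F) ∞ N]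

/-- `g` is a semi-Riemannian metric: a smooth, symmetric, nondegenerate `(0,2)`-tensor field. -/
structure IsSemiRiemannianMetric
    (g : ∀ p : M, TangentSpace 𝓘(ℝ, E) p →L[ℝ] TangentSpace 𝓘(ℝ, E) p →L[ℝ] ℝ) : Prop where
  contMDiff : ContMDiff 𝓘(ℝ, E) (𝓘(ℝ, E).prod 𝓘(ℝ, E →L[ℝ] E →L[ℝ] ℝ)) ∞
    (fun p => TotalSpace.mk' (E →L[ℝ] E →L[ℝ] ℝ) p (g p))
  symm : ∀ p u v, g p u v = g p v u
  nondegenerate : ∀ p u, (∀ v, g p u v = 0) → u = 0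

/-- The vector field near `p` that has constant components in the chart at `p` and the value `v`
at `p`. -/
def coordField (p : M) (v : TangentSpace 𝓘(ℝ, E) p) (q : M) : TangentSpace 𝓘(ℝ, E) q :=
  (trivializationAt E (TangentSpace 𝓘(ℝ, E) : M → Type _) p).symm q
    ((trivializationAt E (TangentSpace 𝓘(ℝ, E) : M → Type _) p) (TotalSpace.mk' E p v)).2

/-- The Christoffel vector `Γ_p(u, v) = ∇_U V (p)`, where `U`, `V` are the vector fields near `p`
that have constant components in the chart at `p` and the values `u`, `v` at `p`
(`coordField`). Such fields commute, so the Koszul formula reads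
`2 g(∇_U V, W) = U g(V, W) + V g(U, W) - W g(U, V)`. -/
def christoffel (g : ∀ p : M, TangentSpace 𝓘(ℝ, E) p →L[ℝ] TangentSpace 𝓘(ℝ, E) p →L[ℝ] ℝ)
    (p : M) (u v : TangentSpace 𝓘(ℝ, E) p) : TangentSpace 𝓘(ℝ, E) p :=
  sharp (g p) fun w => (1 / 2 : ℝ) *
    (mvfderiv 𝓘(ℝ, E) (fun q => g q (coordField p v q) (coordField p w q)) p u
      + mvfderiv 𝓘(ℝ, E) (fun q => g q (coordField p u q) (coordField p w q)) p v
      - mvfderiv 𝓘(ℝ, E) (fun q => g q (coordField p u q) (coordField p v q)) p w)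

/-- The covariant derivative at `x`, in the direction `v`, of a vector field `V` along
`φ : N → M`, for the Levi-Civita connection of the metric `g` of `M`: in the coordinates of `M`
at `φ x`, the derivative of the components of `V` plus the Christoffel term. -/
def covDerivAlong (g : ∀ p : M, TangentSpace 𝓘(ℝ, E) p →L[ℝ] TangentSpace 𝓘(ℝ, E) p →L[ℝ] ℝ)
    (φ : N → M) (V : ∀ x : N, TangentSpace 𝓘(ℝ, E) (φ x)) (x : N)
    (v : TangentSpace 𝓘(ℝ, F) x) : TangentSpace 𝓘(ℝ, E) (φ x) :=
  (trivializationAt E (TangentSpace 𝓘(ℝ, E) : M → Type _) (φ x)).symm (φ x)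
      (mvfderiv 𝓘(ℝ, F) (fun y : N =>
        ((trivializationAt E (TangentSpace 𝓘(ℝ, E) : M → Type _) (φ x))
          (TotalSpace.mk' E (φ y) (V y))).2) x v)
    + christoffel g (φ x) (mfderiv 𝓘(ℝ, F) 𝓘(ℝ, E) φ x v) (V x)

/-- The Levi-Civita connection of `g`: `leviCivita g Y p v = (∇_v Y)(p)`. -/
def leviCivita (g : ∀ p : M, TangentSpace 𝓘(ℝ, E) p →L[ℝ] TangentSpace 𝓘(ℝ, E) p →L[ℝ] ℝ)
    (Y : ∀ p : M, TangentSpace 𝓘(ℝ, E) p) (p : M) (v : TangentSpace 𝓘(ℝ, E) p) :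
    TangentSpace 𝓘(ℝ, E) p :=
  covDerivAlong g (fun q : M => q) Y p v

/-! ### Distributions and foliations -/

/-- `D` is a smooth distribution of rank `k`. -/
def IsSmoothDistribution (k : ℕ) (D : ∀ x : N, Submodule ℝ (TangentSpace 𝓘(ℝ, F) x)) : Prop :=
  ∀ x : N, ∃ U : Set N, IsOpen U ∧ x ∈ U ∧ ∃ X : Fin k → ∀ y : N, TangentSpace 𝓘(ℝ, F) y,
    (∀ i, ContMDiffOn 𝓘(ℝ, F) 𝓘(ℝ, F).tangent ∞
      (fun y => (TotalSpace.mk' F y (X i y) : TangentBundle 𝓘(ℝ, F) N)) U) ∧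
    ∀ y ∈ U, LinearIndependent ℝ (fun i => X i y) ∧
      Submodule.span ℝ (Set.range fun i => X i y) = D y

/-- `X ∈ Γ(D)`: `X` is a smooth vector field on `N` with values in `D`. -/
def IsSection (D : ∀ x : N, Submodule ℝ (TangentSpace 𝓘(ℝ, F) x))
    (X : ∀ x : N, TangentSpace 𝓘(ℝ, F) x) : Prop :=
  ContMDiff 𝓘(ℝ, F) 𝓘(ℝ, F).tangent ∞
    (fun x => (TotalSpace.mk' F x (X x) : TangentBundle 𝓘(ℝ, F) N)) ∧ ∀ x, X x ∈ D x

variable (F) in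
/-- `ξ ∈ Γ(W)`: `ξ` is a smooth vector field along `f : N → M` with values in `W`. -/
def IsSectionAlong (f : N → M) (W : ∀ x : N, Submodule ℝ (TangentSpace 𝓘(ℝ, E) (f x)))
    (ξ : ∀ x : N, TangentSpace 𝓘(ℝ, E) (f x)) : Prop :=
  ContMDiff 𝓘(ℝ, F) 𝓘(ℝ, E).tangent ∞
    (fun x => (TotalSpace.mk' E (f x) (ξ x) : TangentBundle 𝓘(ℝ, E) M)) ∧ ∀ x, ξ x ∈ W x

/-- `D` is the structural distribution of a foliation: a smooth distribution of constant rank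
that is integrable, i.e. closed under the Lie bracket. -/
def IsFoliation (D : ∀ x : N, Submodule ℝ (TangentSpace 𝓘(ℝ, F) x)) : Prop :=
  (∃ k, IsSmoothDistribution k D) ∧
  ∀ X Z : ∀ x : N, TangentSpace 𝓘(ℝ, F) x, IsSection D X → IsSection D Z →
    ∀ x, VectorField.mlieBracket 𝓘(ℝ, F) X Z x ∈ D x

/-- The foliation with structural distribution `D` is totally geodesic in `(N, h)`: the second
fundamental form of its leaves, i.e. the part of `∇_X Z` outside `D` for `X, Z ∈ Γ(D)`,
vanishes. -/
def IsTotallyGeodesicFoliation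
    (h : ∀ x : N, TangentSpace 𝓘(ℝ, F) x →L[ℝ] TangentSpace 𝓘(ℝ, F) x →L[ℝ] ℝ)
    (D : ∀ x : N, Submodule ℝ (TangentSpace 𝓘(ℝ, F) x)) : Prop :=
  IsFoliation D ∧
  ∀ X Z : ∀ x : N, TangentSpace 𝓘(ℝ, F) x, IsSection D X → IsSection D Z →
    ∀ x, leviCivita h Z x (X x) ∈ D x

/-! ### Nondegenerate submanifolds -/

variable (F) in
/-- The metric on `N` induced by `f : N → M`. -/
def inducedMetric (g : ∀ p : M, TangentSpace 𝓘(ℝ, E) p →L[ℝ] TangentSpace 𝓘(ℝ, E) p →L[ℝ] ℝ)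
    (f : N → M) (x : N) : TangentSpace 𝓘(ℝ, F) x →L[ℝ] TangentSpace 𝓘(ℝ, F) x →L[ℝ] ℝ :=
  ((mfderiv 𝓘(ℝ, F) 𝓘(ℝ, E) f x).precomp ℝ) ∘L (g (f x)) ∘L (mfderiv 𝓘(ℝ, F) 𝓘(ℝ, E) f x)

variable (F) in
/-- `f : N → M` is an immersed submanifold of `(M, g)` whose induced metric is nondegenerate. -/
structure IsNondegenerateSubmanifold
    (g : ∀ p : M, TangentSpace 𝓘(ℝ, E) p →L[ℝ] TangentSpace 𝓘(ℝ, E) p →L[ℝ] ℝ)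
    (f : N → M) : Prop where
  contMDiff : ContMDiff 𝓘(ℝ, F) 𝓘(ℝ, E) ∞ f
  immersion : ∀ x, Function.Injective (mfderiv 𝓘(ℝ, F) 𝓘(ℝ, E) f x)
  nondegenerate : ∀ (x : N) (u : TangentSpace 𝓘(ℝ, F) x), (∀ v, inducedMetric F g f x u v = 0) → u = 0

variable (F) in
/-- The normal space `T_x N^⊥ ⊆ T_{f x} M`. -/
def normalSpace (g : ∀ p : M, TangentSpace 𝓘(ℝ, E) p →L[ℝ] TangentSpace 𝓘(ℝ, E) p →L[ℝ] ℝ)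
    (f : N → M) (x : N) : Submodule ℝ (TangentSpace 𝓘(ℝ, E) (f x)) :=
  orthCompl (g (f x))
    (mfderiv 𝓘(ℝ, F) 𝓘(ℝ, E) f x :
      TangentSpace 𝓘(ℝ, F) x →ₗ[ℝ] TangentSpace 𝓘(ℝ, E) (f x)).range

variable (F) in
/-- The tangential part of `w ∈ T_{f x} M`, as an element of `T_x N`. -/
def tangentialPart
    (g : ∀ p : M, TangentSpace 𝓘(ℝ, E) p →L[ℝ] TangentSpace 𝓘(ℝ, E) p →L[ℝ] ℝ)
    (f : N → M) (x : N) (w : TangentSpace 𝓘(ℝ, E) (f x)) : TangentSpace 𝓘(ℝ, F) x :=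
  sharp (inducedMetric F g f x) fun v => g (f x) w (mfderiv 𝓘(ℝ, F) 𝓘(ℝ, E) f x v)

variable (F) in
/-- The normal part of `w ∈ T_{f x} M`. -/
def normalPart (g : ∀ p : M, TangentSpace 𝓘(ℝ, E) p →L[ℝ] TangentSpace 𝓘(ℝ, E) p →L[ℝ] ℝ)
    (f : N → M) (x : N) (w : TangentSpace 𝓘(ℝ, E) (f x)) : TangentSpace 𝓘(ℝ, E) (f x) :=
  w - mfderiv 𝓘(ℝ, F) 𝓘(ℝ, E) f x (tangentialPart F g f x w)

/-- The second fundamental form `B(X, Y)` of `N` in `M`, the normal part of the derivative of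
`Y` in the direction `X` for the Levi-Civita connection of `M`. -/
def secondFundamentalForm
    (g : ∀ p : M, TangentSpace 𝓘(ℝ, E) p →L[ℝ] TangentSpace 𝓘(ℝ, E) p →L[ℝ] ℝ)
    (f : N → M) (X Y : ∀ x : N, TangentSpace 𝓘(ℝ, F) x) (x : N) :
    TangentSpace 𝓘(ℝ, E) (f x) :=
  normalPart F g f x
    (covDerivAlong g f (fun y => mfderiv 𝓘(ℝ, F) 𝓘(ℝ, E) f y (Y y)) x (X x))

/-- The shape operator `A_ξ X`: `-A_ξ X` is the tangential part of the derivative of `ξ` in the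
direction `X` for the Levi-Civita connection of `M`. -/
def shapeOperator
    (g : ∀ p : M, TangentSpace 𝓘(ℝ, E) p →L[ℝ] TangentSpace 𝓘(ℝ, E) p →L[ℝ] ℝ)
    (f : N → M) (ξ : ∀ x : N, TangentSpace 𝓘(ℝ, E) (f x))
    (X : ∀ x : N, TangentSpace 𝓘(ℝ, F) x) (x : N) : TangentSpace 𝓘(ℝ, F) x :=
  -tangentialPart F g f x (covDerivAlong g f ξ x (X x))

end Metric

/-! ### Paraquaternionic Kähler manifolds -/

section Paraquaternionic

variable {E : Type*} [NormedAddCommGroup E] [NormedSpace ℝ E]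
  {M : Type*} [TopologicalSpace M] [ChartedSpace E M] [IsManifold 𝓘(ℝ, E) ∞ M]
  {F : Type*} [NormedAddCommGroup F] [NormedSpace ℝ F]
  {N : Type*} [TopologicalSpace N] [ChartedSpace F N] [IsManifold 𝓘(ℝ, F) ∞ N]

/-- The signs `ε₁ = 1`, `ε₂ = ε₃ = -1`; the indices `1, 2, 3` are `0, 1, 2 : Fin 3`. -/
def pqSign : Fin 3 → ℝ := ![1, -1, -1]

/-- A field of endomorphisms of the tangent spaces is smooth on `U`. -/
def IsSmoothEndOn (S : ∀ p : M, TangentSpace 𝓘(ℝ, E) p →L[ℝ] TangentSpace 𝓘(ℝ, E) p)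
    (U : Set M) : Prop :=
  ContMDiffOn 𝓘(ℝ, E) (𝓘(ℝ, E).prod 𝓘(ℝ, E →L[ℝ] E)) ∞
    (fun p => TotalSpace.mk' (E →L[ℝ] E) p (S p)) U

/-- `J₁, J₂, J₃` is a canonical local basis of `σ ⊆ End(TM)` on the open set `U`:
`J_α² = -ε_α Id` and `J_α J_{α+1} = -J_{α+1} J_α = ε_{α+2} J_{α+2}`, indices modulo `3`. -/
structure IsCanonicalLocalBasis
    (σ : ∀ p : M, Submodule ℝ (TangentSpace 𝓘(ℝ, E) p →L[ℝ] TangentSpace 𝓘(ℝ, E) p))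
    (U : Set M)
    (J : Fin 3 → ∀ p : M, TangentSpace 𝓘(ℝ, E) p →L[ℝ] TangentSpace 𝓘(ℝ, E) p) : Prop where
  isOpen : IsOpen U
  smooth : ∀ α, IsSmoothEndOn (J α) U
  linearIndependent : ∀ p ∈ U, LinearIndependent ℝ fun α => J α p
  span_eq : ∀ p ∈ U, Submodule.span ℝ (Set.range fun α => J α p) = σ p
  sq : ∀ p ∈ U, ∀ α, J α p ∘L J α p = -pqSign α • ContinuousLinearMap.id ℝ _
  mul : ∀ p ∈ U, ∀ α, J α p ∘L J (α + 1) p = pqSign (α + 2) • J (α + 2) p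
  anticomm : ∀ p ∈ U, ∀ α, J α p ∘L J (α + 1) p = -(J (α + 1) p ∘L J α p)

/-- `σ` is an almost paraquaternionic structure on `M`. -/
def IsAlmostParaquaternionic
    (σ : ∀ p : M, Submodule ℝ (TangentSpace 𝓘(ℝ, E) p →L[ℝ] TangentSpace 𝓘(ℝ, E) p)) : Prop :=
  ∀ p : M, ∃ U J, p ∈ U ∧ IsCanonicalLocalBasis σ U J

/-- `(M, σ, g)` is an almost paraquaternionic hermitian manifold. -/
structure IsAlmostParaquaternionicHermitian
    (g : ∀ p : M, TangentSpace 𝓘(ℝ, E) p →L[ℝ] TangentSpace 𝓘(ℝ, E) p →L[ℝ] ℝ)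
    (σ : ∀ p : M, Submodule ℝ (TangentSpace 𝓘(ℝ, E) p →L[ℝ] TangentSpace 𝓘(ℝ, E) p)) :
    Prop where
  metric : IsSemiRiemannianMetric g
  almost : IsAlmostParaquaternionic σ
  adapted : ∀ U J, IsCanonicalLocalBasis σ U J → ∀ p ∈ U, ∀ α u v,
    g p (J α p u) (J α p v) = pqSign α * g p u v

/-- `(M, σ, g)` is a paraquaternionic Kähler manifold: moreover `σ` is parallel for the
Levi-Civita connection, i.e. for each local section `S` of `σ` and each tangent vector `v` the
endomorphism `∇_v S`, given by `(∇_v S) Y = ∇_v (S Y) - S (∇_v Y)`, belongs to `σ`. -/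
structure IsParaquaternionicKahler
    (g : ∀ p : M, TangentSpace 𝓘(ℝ, E) p →L[ℝ] TangentSpace 𝓘(ℝ, E) p →L[ℝ] ℝ)
    (σ : ∀ p : M, Submodule ℝ (TangentSpace 𝓘(ℝ, E) p →L[ℝ] TangentSpace 𝓘(ℝ, E) p)) :
    Prop extends IsAlmostParaquaternionicHermitian g σ where
  parallel : ∀ (U : Set M) (S : ∀ p : M, TangentSpace 𝓘(ℝ, E) p →L[ℝ] TangentSpace 𝓘(ℝ, E) p),
    IsOpen U → IsSmoothEndOn S U → (∀ p ∈ U, S p ∈ σ p) →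
    ∀ p ∈ U, ∀ v : TangentSpace 𝓘(ℝ, E) p, ∃ T ∈ σ p,
      ∀ Y : ∀ q : M, TangentSpace 𝓘(ℝ, E) q,
        ContMDiffAt 𝓘(ℝ, E) 𝓘(ℝ, E).tangent ∞
          (fun q => (TotalSpace.mk' E q (Y q) : TangentBundle 𝓘(ℝ, E) M)) p →
        leviCivita g (fun q => S q (Y q)) p v - S p (leviCivita g Y p v) = T (Y p)

/-! ### Paraquaternionic CR-submanifolds -/

/-- The orthogonal complement `D^⊥` of a distribution `D` in `TN`. -/
def distPerp (g : ∀ p : M, TangentSpace 𝓘(ℝ, E) p →L[ℝ] TangentSpace 𝓘(ℝ, E) p →L[ℝ] ℝ)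
    (f : N → M) (D : ∀ x : N, Submodule ℝ (TangentSpace 𝓘(ℝ, F) x)) (x : N) :
    Submodule ℝ (TangentSpace 𝓘(ℝ, F) x) :=
  orthCompl (inducedMetric F g f x) (D x)

/-- The image of `W ⊆ T_x N` in `T_{f x} M`. -/
def tangentImage (f : N → M) (x : N) (W : Submodule ℝ (TangentSpace 𝓘(ℝ, F) x)) :
    Submodule ℝ (TangentSpace 𝓘(ℝ, E) (f x)) :=
  W.map (mfderiv 𝓘(ℝ, F) 𝓘(ℝ, E) f x :
    TangentSpace 𝓘(ℝ, F) x →ₗ[ℝ] TangentSpace 𝓘(ℝ, E) (f x))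

/-- `f : N → M` is a paraquaternionic CR-submanifold of `(M, σ, g)`, with paraquaternionic
distribution `D` and totally real distribution `D^⊥`. -/
structure IsParaquaternionicCR
    (g : ∀ p : M, TangentSpace 𝓘(ℝ, E) p →L[ℝ] TangentSpace 𝓘(ℝ, E) p →L[ℝ] ℝ)
    (σ : ∀ p : M, Submodule ℝ (TangentSpace 𝓘(ℝ, E) p →L[ℝ] TangentSpace 𝓘(ℝ, E) p))
    (f : N → M) (D : ∀ x : N, Submodule ℝ (TangentSpace 𝓘(ℝ, F) x)) : Prop
    extends IsNondegenerateSubmanifold F g f where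
  distribution : ∃ k, IsSmoothDistribution k D
  dist_nondegenerate : ∀ x, ∀ u ∈ D x, (∀ v ∈ D x, inducedMetric F g f x u v = 0) → u = 0
  paraquaternionic : ∀ U J, IsCanonicalLocalBasis σ U J → ∀ x, f x ∈ U → ∀ α,
    (tangentImage f x (D x)).map
        (J α (f x) : TangentSpace 𝓘(ℝ, E) (f x) →ₗ[ℝ] TangentSpace 𝓘(ℝ, E) (f x))
      = tangentImage f x (D x)
  totallyReal : ∀ U J, IsCanonicalLocalBasis σ U J → ∀ x, f x ∈ U → ∀ α,
    (tangentImage f x (distPerp g f D x)).map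
      (J α (f x) : TangentSpace 𝓘(ℝ, E) (f x) →ₗ[ℝ] TangentSpace 𝓘(ℝ, E) (f x)) ≤ normalSpace F g f x

/-- `ν_x^⊥`, the sum of the images of `D_x^⊥` under the elements of `σ`; by
`nuPerp_eq` it is `J₁ D_x^⊥ + J₂ D_x^⊥ + J₃ D_x^⊥` for each canonical local basis. -/
def nuPerp (g : ∀ p : M, TangentSpace 𝓘(ℝ, E) p →L[ℝ] TangentSpace 𝓘(ℝ, E) p →L[ℝ] ℝ)
    (σ : ∀ p : M, Submodule ℝ (TangentSpace 𝓘(ℝ, E) p →L[ℝ] TangentSpace 𝓘(ℝ, E) p))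
    (f : N → M) (D : ∀ x : N, Submodule ℝ (TangentSpace 𝓘(ℝ, F) x)) (x : N) :
    Submodule ℝ (TangentSpace 𝓘(ℝ, E) (f x)) :=
  ⨆ S ∈ σ (f x), (tangentImage f x (distPerp g f D x)).map
    (S : TangentSpace 𝓘(ℝ, E) (f x) →ₗ[ℝ] TangentSpace 𝓘(ℝ, E) (f x))

theorem nuPerp_eq
    (g : ∀ p : M, TangentSpace 𝓘(ℝ, E) p →L[ℝ] TangentSpace 𝓘(ℝ, E) p →L[ℝ] ℝ)
    (σ : ∀ p : M, Submodule ℝ (TangentSpace 𝓘(ℝ, E) p →L[ℝ] TangentSpace 𝓘(ℝ, E) p))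
    (f : N → M) (D : ∀ x : N, Submodule ℝ (TangentSpace 𝓘(ℝ, F) x)) {U : Set M}
    {J : Fin 3 → ∀ p : M, TangentSpace 𝓘(ℝ, E) p →L[ℝ] TangentSpace 𝓘(ℝ, E) p}
    (hJ : IsCanonicalLocalBasis σ U J) (x : N) (hx : f x ∈ U) :
    nuPerp g σ f D x = ⨆ α, (tangentImage f x (distPerp g f D x)).map
      (J α (f x) : TangentSpace 𝓘(ℝ, E) (f x) →ₗ[ℝ] TangentSpace 𝓘(ℝ, E) (f x)) := by
  apply le_antisymm
  · refine iSup₂_le fun S hS => ?_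
    rw [← hJ.span_eq _ hx] at hS
    rintro _ ⟨u, hu, rfl⟩
    induction hS using Submodule.span_induction with
    | mem S hS =>
      obtain ⟨α, rfl⟩ := hS
      exact Submodule.mem_iSup_of_mem α ⟨u, hu, rfl⟩
    | zero => exact Submodule.zero_mem _
    | add S T _ _ h1 h2 => exact Submodule.add_mem _ h1 h2
    | smul c S _ h => exact Submodule.smul_mem _ c h
  · refine iSup_le fun α => ?_
    refine le_iSup₂_of_le (J α (f x)) ?_ le_rfl
    rw [← hJ.span_eq _ hx]
    exact Submodule.subset_span ⟨α, rfl⟩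

/-- `ν_x`, the orthogonal complement of `ν_x^⊥` in the normal space `T_x N^⊥`. -/
def nu (g : ∀ p : M, TangentSpace 𝓘(ℝ, E) p →L[ℝ] TangentSpace 𝓘(ℝ, E) p →L[ℝ] ℝ)
    (σ : ∀ p : M, Submodule ℝ (TangentSpace 𝓘(ℝ, E) p →L[ℝ] TangentSpace 𝓘(ℝ, E) p))
    (f : N → M) (D : ∀ x : N, Submodule ℝ (TangentSpace 𝓘(ℝ, F) x)) (x : N) :
    Submodule ℝ (TangentSpace 𝓘(ℝ, E) (f x)) :=
  normalSpace F g f x ⊓ orthCompl (g (f x)) (nuPerp g σ f D x)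

/-- `N` is mixed geodesic: `B(X, Y) = 0` for `X ∈ Γ(D)`, `Y ∈ Γ(D^⊥)`. -/
def IsMixedGeodesic
    (g : ∀ p : M, TangentSpace 𝓘(ℝ, E) p →L[ℝ] TangentSpace 𝓘(ℝ, E) p →L[ℝ] ℝ)
    (f : N → M) (D : ∀ x : N, Submodule ℝ (TangentSpace 𝓘(ℝ, F) x)) : Prop :=
  ∀ X Y : ∀ x : N, TangentSpace 𝓘(ℝ, F) x, IsSection D X → IsSection (distPerp g f D) Y →
    ∀ x, secondFundamentalForm g f X Y x = 0

end Paraquaternionic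

end

/-!
A section `S` of `σ` is skew with respect to `g` and maps `D^⊥` into the normal bundle. For
`Z ∈ Γ(D^⊥)` the fields `S Z` and `Y ∈ Γ(TN)` are therefore orthogonal. Differentiating
`g(S Z, Y) = 0` in the direction `X`, the term that contains the derivative of `S` disappears: it
applies to `Z` an element of `σ`, because `σ` is parallel, and so is normal. This leaves
`g(S Z, B(X, Y)) = g(∇̄_X Z, S Y)`.

For `Y ∈ Γ(D)` and `X, Z ∈ Γ(D^⊥)` the formula with `X` and `Y` exchanged shows that the left side
is symmetric in `X` and `Z`, so `[X, Z]` is orthogonal to `S D = D` for `S = J₁`, which is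
integrability. As the right side is `g(∇_X Z, S Y)`, it vanishes for all such `X, Y, Z` exactly when
`D^⊥` is totally geodesic, whereas the left side vanishes exactly when `B(X, Y) ∈ Γ(ν)`. The shape
operators enter through `g(A_ξ X, Y) = g(ξ, B(X, Y))`.
-/

section Linear

theorem linearIndependent_symm_inr_and_span_eq_ker {R V W K ι : Type*} [Semiring R]
    [AddCommMonoid V] [Module R V] [AddCommMonoid W] [Module R W] [AddCommMonoid K] [Module R K]
    (e : V ≃ₗ[R] W × K) (κ : Module.Basis ι R K) :
    LinearIndependent R (fun j => e.symm (0, κ j)) ∧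
      Submodule.span R (range fun j => e.symm (0, κ j)) = (LinearMap.fst R W K ∘ₗ e).ker := by
  let L : K →ₗ[R] V := e.symm.toLinearMap ∘ₗ LinearMap.inr R W K
  have hL : Function.Injective L := e.symm.injective.comp LinearMap.inr_injective
  refine ⟨κ.linearIndependent.map_injOn L hL.injOn, ?_⟩
  have hrange : range (fun j => e.symm (0, κ j)) = L '' range κ := range_comp L κ
  rw [hrange, ← Submodule.map_span, κ.span_eq, Submodule.map_top]
  ext v
  constructor
  · rintro ⟨c, rfl⟩
    exact congrArg Prod.fst (e.apply_symm_apply (0, c))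
  · intro hv
    exact ⟨(e v).2, e.symm_apply_eq.2 (Prod.ext (Eq.symm hv) rfl)⟩

theorem exists_contDiffOn_basis_ker {F G : Type*} [NormedAddCommGroup F] [NormedSpace ℝ F]
    [FiniteDimensional ℝ F] [NormedAddCommGroup G] [NormedSpace ℝ G] [FiniteDimensional ℝ G]
    {A₀ : F →L[ℝ] G} (hA₀ : Function.Surjective A₀) :
    ∃ W : Set (F →L[ℝ] G), IsOpen W ∧ A₀ ∈ W ∧
      ∃ s : Fin (Module.finrank ℝ F - Module.finrank ℝ G) → (F →L[ℝ] G) → F,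
        (∀ j, ContDiffOn ℝ ∞ (s j) W) ∧ ∀ A ∈ W,
          LinearIndependent ℝ (fun j => s j A) ∧
            Submodule.span ℝ (range fun j => s j A) = A.ker := by
  have : CompleteSpace F := FiniteDimensional.complete ℝ F
  obtain ⟨P, hP⟩ := A₀.ker_closedComplemented_of_finiteDimensional_range
  have hfinrank : Module.finrank ℝ A₀.ker = Module.finrank ℝ F - Module.finrank ℝ G := by
    have hnullity := LinearMap.finrank_range_add_finrank_ker (A₀ : F →ₗ[ℝ] G)
    rw [LinearMap.range_eq_top.2 hA₀, finrank_top] at hnullity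
    exact Nat.eq_sub_of_add_eq' hnullity
  let κ := Module.finBasisOfFinrankEq ℝ A₀.ker hfinrank
  let extend (A : F →L[ℝ] G) : F →L[ℝ] G × A₀.ker := A.prod P
  have hextend : ContDiff ℝ ∞ extend := contDiff_clm_apply_iff.2 fun v =>
    (contDiff_id.clm_apply contDiff_const).prodMk contDiff_const
  refine ⟨extend ⁻¹' range ((↑) : (F ≃L[ℝ] G × A₀.ker) → _),
    ContinuousLinearEquiv.isOpen.preimage hextend.continuous, ?_,
    fun j A => (extend A).inverse (0, κ j), fun j => ?_, ?_⟩
  · exact ⟨ContinuousLinearMap.equivProdOfSurjectiveOfIsCompl A₀ P (LinearMap.range_eq_top.2 hA₀)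
      (LinearMap.range_eq_of_proj hP) (LinearMap.isCompl_of_proj hP), rfl⟩
  · rintro A ⟨e, he⟩
    have hinverse := contDiffAt_map_inverse (n := ∞) e
    rw [he] at hinverse
    exact ((hinverse.comp A hextend.contDiffAt).clm_apply contDiffAt_const).contDiffWithinAt
  · rintro A ⟨e, he⟩
    have hker : (LinearMap.fst ℝ G A₀.ker ∘ₗ e.toLinearEquiv.toLinearMap).ker = A.ker := by
      ext v
      exact Eq.congr_left (congrArg Prod.fst (DFunLike.congr_fun he v))
    simp only [← he, ContinuousLinearMap.inverse_equiv, ← hker]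
    exact linearIndependent_symm_inr_and_span_eq_ker e.toLinearEquiv κ

end Linear

section Calculus

variable {F : Type*} [NormedAddCommGroup F] [NormedSpace ℝ F]
  {N : Type*} [TopologicalSpace N] [ChartedSpace F N]
  {G : Type*} [NormedAddCommGroup G] [NormedSpace ℝ G]
  {H : Type*} [NormedAddCommGroup H] [NormedSpace ℝ H] {x : N}

theorem mvfderiv_congr_of_eventuallyEq {a b : N → G} (h : a =ᶠ[𝓝 x] b) :
    mvfderiv 𝓘(ℝ, F) a x = mvfderiv 𝓘(ℝ, F) b x := by
  ext v
  simp only [mvfderiv, h.mfderiv_eq]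
  rfl

theorem differentiableAt_comp_extChartAt_symm {a : N → G}
    (ha : MDifferentiableAt 𝓘(ℝ, F) 𝓘(ℝ, G) a x) :
    DifferentiableAt ℝ (a ∘ (extChartAt 𝓘(ℝ, F) x).symm) (extChartAt 𝓘(ℝ, F) x x) := by
  have h := ha.differentiableWithinAt_writtenInExtChartAt
  rw [modelWithCornersSelf_coe, range_id, differentiableWithinAt_univ] at h
  exact h

theorem mvfderiv_apply_eq_fderiv {a : N → G} (ha : MDifferentiableAt 𝓘(ℝ, F) 𝓘(ℝ, G) a x)
    (v : TangentSpace 𝓘(ℝ, F) x) :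
    mvfderiv 𝓘(ℝ, F) a x v
      = fderiv ℝ (a ∘ (extChartAt 𝓘(ℝ, F) x).symm) (extChartAt 𝓘(ℝ, F) x x) v := by
  simp only [mvfderiv, ha.mfderiv, modelWithCornersSelf_coe, range_id, fderivWithin_univ]
  rfl

theorem mvfderiv_clm_apply {c : N → G →L[ℝ] H} {u : N → G}
    (hc : MDifferentiableAt 𝓘(ℝ, F) 𝓘(ℝ, G →L[ℝ] H) c x)
    (hu : MDifferentiableAt 𝓘(ℝ, F) 𝓘(ℝ, G) u x) (v : TangentSpace 𝓘(ℝ, F) x) :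
    mvfderiv 𝓘(ℝ, F) (fun y => c y (u y)) x v
      = mvfderiv 𝓘(ℝ, F) c x v (u x) + c x (mvfderiv 𝓘(ℝ, F) u x v) := by
  rw [mvfderiv_apply_eq_fderiv (hc.clm_apply hu), mvfderiv_apply_eq_fderiv hc,
    mvfderiv_apply_eq_fderiv hu]
  have h := fderiv_clm_apply (differentiableAt_comp_extChartAt_symm hc)
    (differentiableAt_comp_extChartAt_symm hu)
  simpa [add_comm] using! DFunLike.congr_fun h v

end Calculus

section Coordinates

variable {E : Type*} [NormedAddCommGroup E] [NormedSpace ℝ E]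
  {M : Type*} [TopologicalSpace M] [ChartedSpace E M] [IsManifold 𝓘(ℝ, E) ∞ M]

/-- The components, in the chart at `p`, of a tangent vector at `q`. -/
noncomputable def coordMap (p q : M) : TangentSpace 𝓘(ℝ, E) q →L[ℝ] E :=
  (trivializationAt E (TangentSpace 𝓘(ℝ, E) : M → Type _) p).continuousLinearMapAt ℝ q

/-- The tangent vector at `q` with given components in the chart at `p`. -/
noncomputable def frameMap (p q : M) : E →L[ℝ] TangentSpace 𝓘(ℝ, E) q :=
  (trivializationAt E (TangentSpace 𝓘(ℝ, E) : M → Type _) p).symmL ℝ q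

variable {p q : M}

theorem trivializationAt_snd_eq_coordMap (hq : q ∈ (chartAt E p).source)
    (v : TangentSpace 𝓘(ℝ, E) q) :
    (trivializationAt E (TangentSpace 𝓘(ℝ, E) : M → Type _) p (TotalSpace.mk' E q v)).2
      = coordMap p q v := by
  rw [coordMap, Trivialization.continuousLinearMapAt_apply, Trivialization.linearMapAt_apply,
    if_pos (by exact hq)]

theorem trivializationAt_symm_eq_frameMap (hq : q ∈ (chartAt E p).source) (e : E) :
    (trivializationAt E (TangentSpace 𝓘(ℝ, E) : M → Type _) p).symm q e = frameMap p q e :=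
  (Trivialization.symmL_apply _ hq e).symm

theorem frameMap_coordMap (hq : q ∈ (chartAt E p).source) (v : TangentSpace 𝓘(ℝ, E) q) :
    frameMap p q (coordMap p q v) = v :=
  (trivializationAt E (TangentSpace 𝓘(ℝ, E) : M → Type _) p).symmL_continuousLinearMapAt hq v

theorem coordMap_frameMap (hq : q ∈ (chartAt E p).source) (e : E) :
    coordMap p q (frameMap p q e) = e :=
  (trivializationAt E (TangentSpace 𝓘(ℝ, E) : M → Type _) p).continuousLinearMapAt_symmL hq e

theorem frameMap_coordMap_self (p : M) (v : TangentSpace 𝓘(ℝ, E) p) :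
    frameMap p p (coordMap p p v) = v :=
  frameMap_coordMap (mem_chart_source E p) v

theorem coordField_eq_frameMap (hq : q ∈ (chartAt E p).source) (v : TangentSpace 𝓘(ℝ, E) p) :
    coordField p v q = frameMap p q (coordMap p p v) := by
  rw [coordField, trivializationAt_snd_eq_coordMap (mem_chart_source E p),
    trivializationAt_symm_eq_frameMap hq]

theorem coordField_self (p : M) (v : TangentSpace 𝓘(ℝ, E) p) : coordField p v p = v := by
  rw [coordField_eq_frameMap (mem_chart_source E p), frameMap_coordMap_self]

/-- The matrix of the bilinear form `b` on `T_q M` in the chart at `p`. -/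
noncomputable def coordForm (p q : M)
    (b : TangentSpace 𝓘(ℝ, E) q →L[ℝ] TangentSpace 𝓘(ℝ, E) q →L[ℝ] ℝ) : E →L[ℝ] E →L[ℝ] ℝ :=
  (frameMap p q).precomp ℝ ∘L b ∘L frameMap p q

theorem coordForm_apply (b : TangentSpace 𝓘(ℝ, E) q →L[ℝ] TangentSpace 𝓘(ℝ, E) q →L[ℝ] ℝ)
    (e e' : E) : coordForm p q b e e' = b (frameMap p q e) (frameMap p q e') := rfl

theorem apply_eq_coordForm (hq : q ∈ (chartAt E p).source)
    (b : TangentSpace 𝓘(ℝ, E) q →L[ℝ] TangentSpace 𝓘(ℝ, E) q →L[ℝ] ℝ)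
    (u v : TangentSpace 𝓘(ℝ, E) q) :
    b u v = coordForm p q b (coordMap p q u) (coordMap p q v) := by
  rw [coordForm_apply, frameMap_coordMap hq, frameMap_coordMap hq]

theorem inCoordinates_eq_coordForm (hq : q ∈ (chartAt E p).source)
    (b : TangentSpace 𝓘(ℝ, E) q →L[ℝ] TangentSpace 𝓘(ℝ, E) q →L[ℝ] ℝ) :
    ContinuousLinearMap.inCoordinates E (TangentSpace 𝓘(ℝ, E) : M → Type _) (E →L[ℝ] ℝ)
      (fun r : M => TangentSpace 𝓘(ℝ, E) r →L[ℝ] ℝ) p q p q b = coordForm p q b := by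
  ext e e'
  rw [inCoordinates_apply_eq₂ (E₃ := Bundle.Trivial M ℝ) hq hq (mem_univ _),
    trivializationAt_symm_eq_frameMap hq, trivializationAt_symm_eq_frameMap hq]
  simp [coordForm_apply]

set_option synthInstance.maxHeartbeats 400000 in
-- The bundle of bilinear forms is a hom bundle into a hom bundle, whose instances are slow to find.
theorem contMDiffAt_form_iff
    {g : ∀ p : M, TangentSpace 𝓘(ℝ, E) p →L[ℝ] TangentSpace 𝓘(ℝ, E) p →L[ℝ] ℝ}
    (hq : q ∈ (chartAt E p).source) :
    ContMDiffAt 𝓘(ℝ, E) (𝓘(ℝ, E).prod 𝓘(ℝ, E →L[ℝ] E →L[ℝ] ℝ)) ∞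
        (fun r => TotalSpace.mk' (E →L[ℝ] E →L[ℝ] ℝ) r (g r)) q ↔
      ContMDiffAt 𝓘(ℝ, E) 𝓘(ℝ, E →L[ℝ] E →L[ℝ] ℝ) ∞ (fun r => coordForm p r (g r)) q := by
  refine (Trivialization.contMDiffAt_section_iff (trivializationAt (E →L[ℝ] E →L[ℝ] ℝ)
    (fun r : M => TangentSpace 𝓘(ℝ, E) r →L[ℝ] TangentSpace 𝓘(ℝ, E) r →L[ℝ] ℝ) p)
    (by exact ⟨hq, hq, mem_univ q⟩)).trans ?_
  refine Filter.EventuallyEq.contMDiffAt_iff ?_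
  filter_upwards [(chartAt E p).open_source.mem_nhds hq] with r hr
  exact inCoordinates_eq_coordForm hr (g r)

theorem contMDiffAt_vectorField_iff {X : ∀ r : M, TangentSpace 𝓘(ℝ, E) r}
    (hq : q ∈ (chartAt E p).source) :
    ContMDiffAt 𝓘(ℝ, E) 𝓘(ℝ, E).tangent ∞
        (fun r => (TotalSpace.mk' E r (X r) : TangentBundle 𝓘(ℝ, E) M)) q ↔
      ContMDiffAt 𝓘(ℝ, E) 𝓘(ℝ, E) ∞ (fun r => coordMap p r (X r)) q := by
  refine (Trivialization.contMDiffAt_section_iff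
    (trivializationAt E (TangentSpace 𝓘(ℝ, E) : M → Type _) p) hq).trans ?_
  refine Filter.EventuallyEq.contMDiffAt_iff ?_
  filter_upwards [(chartAt E p).open_source.mem_nhds hq] with r hr
  exact trivializationAt_snd_eq_coordMap hr _

end Coordinates

section Connection

variable {E : Type*} [NormedAddCommGroup E] [NormedSpace ℝ E]
  {M : Type*} [TopologicalSpace M] [ChartedSpace E M] [IsManifold 𝓘(ℝ, E) ∞ M]
  {F : Type*} [NormedAddCommGroup F] [NormedSpace ℝ F]
  {N : Type*} [TopologicalSpace N] [ChartedSpace F N]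
  {g : ∀ p : M, TangentSpace 𝓘(ℝ, E) p →L[ℝ] TangentSpace 𝓘(ℝ, E) p →L[ℝ] ℝ}
  {p : M} {φ : N → M} {x : N} {V W : ∀ y : N, TangentSpace 𝓘(ℝ, E) (φ y)}

variable (F) in
/-- The vector field `V` along `φ : N → M` is differentiable at `x`. A vector field on `N` is a
vector field along `fun y => y`. -/
def MDifferentiableAlongAt (φ : N → M) (V : ∀ y : N, TangentSpace 𝓘(ℝ, E) (φ y)) (x : N) : Prop :=
  MDifferentiableAt 𝓘(ℝ, F) 𝓘(ℝ, E).tangent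
    (fun y => (TotalSpace.mk' E (φ y) (V y) : TangentBundle 𝓘(ℝ, E) M)) x

theorem trivializationAt_snd_eventuallyEq (hφ : ContinuousAt φ x)
    (V : ∀ y : N, TangentSpace 𝓘(ℝ, E) (φ y)) :
    (fun y => (trivializationAt E (TangentSpace 𝓘(ℝ, E) : M → Type _) (φ x)
      (TotalSpace.mk' E (φ y) (V y))).2) =ᶠ[𝓝 x] fun y => coordMap (φ x) (φ y) (V y) := by
  filter_upwards [hφ.eventually (chart_source_mem_nhds E (φ x))] with y hy
  exact trivializationAt_snd_eq_coordMap hy _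

theorem mdifferentiableAlongAt_iff :
    MDifferentiableAlongAt F φ V x ↔ MDifferentiableAt 𝓘(ℝ, F) 𝓘(ℝ, E) φ x ∧
      MDifferentiableAt 𝓘(ℝ, F) 𝓘(ℝ, E) (fun y => coordMap (φ x) (φ y) (V y)) x := by
  rw [MDifferentiableAlongAt, mdifferentiableAt_totalSpace]
  refine and_congr_right fun hφ => ?_
  exact (trivializationAt_snd_eventuallyEq hφ.continuousAt V).mdifferentiableAt_iff

theorem mdifferentiableAlongAt_coordField (p : M) (v : TangentSpace 𝓘(ℝ, E) p) :
    MDifferentiableAlongAt E (fun q : M => q) (coordField p v) p := by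
  refine mdifferentiableAlongAt_iff.2 ⟨mdifferentiableAt_id, ?_⟩
  refine (mdifferentiableAt_const (c := coordMap p p v)).congr_of_eventuallyEq ?_
  filter_upwards [chart_source_mem_nhds E p] with q hq
  rw [coordField_eq_frameMap hq, coordMap_frameMap hq]

theorem covDerivAlong_eq (hφ : ContinuousAt φ x) (v : TangentSpace 𝓘(ℝ, F) x) :
    covDerivAlong g φ V x v
      = frameMap (φ x) (φ x) (mvfderiv 𝓘(ℝ, F) (fun y : N => coordMap (φ x) (φ y) (V y)) x v)
        + christoffel g (φ x) (mfderiv 𝓘(ℝ, F) 𝓘(ℝ, E) φ x v) (V x) := by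
  rw [covDerivAlong, trivializationAt_symm_eq_frameMap (mem_chart_source E (φ x)),
    mvfderiv_congr_of_eventuallyEq (trivializationAt_snd_eventuallyEq hφ V)]

variable (g) in
/-- The derivative `a g(U, V)` at `p`, where `U`, `V` are the vector fields that have constant
components in the chart at `p` and the values `u`, `v` at `p`. -/
noncomputable def metricDeriv (p : M) (a u v : TangentSpace 𝓘(ℝ, E) p) : ℝ :=
  mvfderiv 𝓘(ℝ, E) (fun q => coordForm p q (g q)) p a (coordMap p p u) (coordMap p p v)

namespace IsSemiRiemannianMetric

theorem mdifferentiableAt_coordForm (hg : IsSemiRiemannianMetric g) (p : M) :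
    MDifferentiableAt 𝓘(ℝ, E) 𝓘(ℝ, E →L[ℝ] E →L[ℝ] ℝ) (fun q => coordForm p q (g q)) p :=
  ((contMDiffAt_form_iff (mem_chart_source E p)).1 (hg.contMDiff p)).mdifferentiableAt (by simp)

theorem mvfderiv_apply_apply (hg : IsSemiRiemannianMetric g) (hV : MDifferentiableAlongAt F φ V x)
    (hW : MDifferentiableAlongAt F φ W x) (v : TangentSpace 𝓘(ℝ, F) x) :
    mvfderiv 𝓘(ℝ, F) (fun y => g (φ y) (V y) (W y)) x v
      = metricDeriv g (φ x) (mfderiv 𝓘(ℝ, F) 𝓘(ℝ, E) φ x v) (V x) (W x)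
        + g (φ x) (frameMap (φ x) (φ x)
            (mvfderiv 𝓘(ℝ, F) (fun y => coordMap (φ x) (φ y) (V y)) x v)) (W x)
        + g (φ x) (V x) (frameMap (φ x) (φ x)
            (mvfderiv 𝓘(ℝ, F) (fun y => coordMap (φ x) (φ y) (W y)) x v)) := by
  obtain ⟨hφ, hV⟩ := mdifferentiableAlongAt_iff.1 hV
  have hW := (mdifferentiableAlongAt_iff.1 hW).2
  have hG := hg.mdifferentiableAt_coordForm (φ x)
  have hGφ : MDifferentiableAt 𝓘(ℝ, F) 𝓘(ℝ, E →L[ℝ] E →L[ℝ] ℝ)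
      (fun y => coordForm (φ x) (φ y) (g (φ y))) x := hG.comp x hφ
  have hderiv : mvfderiv 𝓘(ℝ, F) (fun y => coordForm (φ x) (φ y) (g (φ y))) x v
      = mvfderiv 𝓘(ℝ, E) (fun q => coordForm (φ x) q (g q)) (φ x)
          (mfderiv 𝓘(ℝ, F) 𝓘(ℝ, E) φ x v) := mfderiv_comp_apply x hG hφ v
  have hlocal : (fun y => g (φ y) (V y) (W y)) =ᶠ[𝓝 x] fun y =>
      coordForm (φ x) (φ y) (g (φ y)) (coordMap (φ x) (φ y) (V y))
        (coordMap (φ x) (φ y) (W y)) := by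
    filter_upwards [hφ.continuousAt.eventually (chart_source_mem_nhds E (φ x))] with y hy
    exact apply_eq_coordForm hy _ _ _
  rw [mvfderiv_congr_of_eventuallyEq hlocal, mvfderiv_clm_apply (hGφ.clm_apply hV) hW,
    mvfderiv_clm_apply hGφ hV, hderiv]
  simp only [add_apply, coordForm_apply, frameMap_coordMap_self, metricDeriv]

theorem mvfderiv_coordField (hg : IsSemiRiemannianMetric g) (p : M)
    (a u v : TangentSpace 𝓘(ℝ, E) p) :
    mvfderiv 𝓘(ℝ, E) (fun q => g q (coordField p u q) (coordField p v q)) p a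
      = metricDeriv g p a u v := by
  have hconst : ∀ w : TangentSpace 𝓘(ℝ, E) p,
      mvfderiv 𝓘(ℝ, E) (fun q => coordMap p q (coordField p w q)) p = 0 := fun w => by
    refine (mvfderiv_congr_of_eventuallyEq (b := fun _ => coordMap p p w) ?_).trans
      (mvfderiv_const _)
    filter_upwards [chart_source_mem_nhds E p] with q hq
    rw [coordField_eq_frameMap hq, coordMap_frameMap hq]
  rw [hg.mvfderiv_apply_apply (φ := fun q : M => q) (mdifferentiableAlongAt_coordField p u)
    (mdifferentiableAlongAt_coordField p v), hconst, hconst, coordField_self, coordField_self,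
    show mfderiv 𝓘(ℝ, E) 𝓘(ℝ, E) (fun q : M => q) p = _ from mfderiv_id]
  simp

theorem metricDeriv_symm (hg : IsSemiRiemannianMetric g) (a u v : TangentSpace 𝓘(ℝ, E) p) :
    metricDeriv g p a u v = metricDeriv g p a v u := by
  rw [← hg.mvfderiv_coordField, ← hg.mvfderiv_coordField]
  simp only [hg.symm _ (coordField p u _)]

theorem christoffel_symm (hg : IsSemiRiemannianMetric g) (u v : TangentSpace 𝓘(ℝ, E) p) :
    christoffel g p u v = christoffel g p v u := by
  simp only [christoffel, hg.mvfderiv_coordField, hg.metricDeriv_symm _ u v]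
  simp only [add_comm]

variable [FiniteDimensional ℝ E]

theorem apply_christoffel (hg : IsSemiRiemannianMetric g) (u v w : TangentSpace 𝓘(ℝ, E) p) :
    g p (christoffel g p u v) w
      = 1 / 2 * (metricDeriv g p u v w + metricDeriv g p v u w - metricDeriv g p w u v) := by
  have : FiniteDimensional ℝ (TangentSpace 𝓘(ℝ, E) p) := ‹FiniteDimensional ℝ E›
  let D : TangentSpace 𝓘(ℝ, E) p →L[ℝ] E →L[ℝ] E →L[ℝ] ℝ :=
    mvfderiv 𝓘(ℝ, E) (fun q => coordForm p q (g q)) p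
  let koszul : TangentSpace 𝓘(ℝ, E) p →L[ℝ] ℝ := (1 / 2 : ℝ) •
    (D u (coordMap p p v) ∘L coordMap p p + D v (coordMap p p u) ∘L coordMap p p
      - ContinuousLinearMap.apply ℝ ℝ (coordMap p p v) ∘L
          ContinuousLinearMap.apply ℝ (E →L[ℝ] ℝ) (coordMap p p u) ∘L D)
  simp only [christoffel, hg.mvfderiv_coordField]
  exact sharp_spec (g p) (hg.nondegenerate p) koszul.toLinearMap w

theorem christoffel_metric (hg : IsSemiRiemannianMetric g) (a u v : TangentSpace 𝓘(ℝ, E) p) :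
    g p (christoffel g p a u) v + g p u (christoffel g p a v) = metricDeriv g p a u v := by
  rw [hg.symm p u, hg.apply_christoffel, hg.apply_christoffel, hg.metricDeriv_symm a v u,
    hg.metricDeriv_symm u a v, hg.metricDeriv_symm v a u]
  ring

theorem mvfderiv_apply_apply_eq_covDerivAlong (hg : IsSemiRiemannianMetric g)
    (hV : MDifferentiableAlongAt F φ V x) (hW : MDifferentiableAlongAt F φ W x)
    (v : TangentSpace 𝓘(ℝ, F) x) :
    mvfderiv 𝓘(ℝ, F) (fun y => g (φ y) (V y) (W y)) x v
      = g (φ x) (covDerivAlong g φ V x v) (W x) + g (φ x) (V x) (covDerivAlong g φ W x v) := by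
  have hφ := (mdifferentiableAlongAt_iff.1 hV).1.continuousAt
  rw [hg.mvfderiv_apply_apply hV hW, ← hg.christoffel_metric, covDerivAlong_eq hφ,
    covDerivAlong_eq hφ]
  simp only [map_add, add_apply]
  ring

theorem covDerivAlong_orthogonal (hg : IsSemiRiemannianMetric g)
    (hV : MDifferentiableAlongAt F φ V x) (hW : MDifferentiableAlongAt F φ W x)
    (horth : ∀ᶠ y in 𝓝 x, g (φ y) (V y) (W y) = 0) (v : TangentSpace 𝓘(ℝ, F) x) :
    g (φ x) (covDerivAlong g φ V x v) (W x) = -g (φ x) (V x) (covDerivAlong g φ W x v) := by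
  have hzero : (fun y => g (φ y) (V y) (W y)) =ᶠ[𝓝 x] fun _ => 0 := horth
  have hcompat := hg.mvfderiv_apply_apply_eq_covDerivAlong hV hW v
  rw [mvfderiv_congr_of_eventuallyEq hzero, mvfderiv_const] at hcompat
  exact eq_neg_of_add_eq_zero_left hcompat.symm

end IsSemiRiemannianMetric

end Connection

section CoordinateDerivative

variable {F : Type*} [NormedAddCommGroup F] [NormedSpace ℝ F]
  {N : Type*} [TopologicalSpace N] [ChartedSpace F N] {x : N} {e : F}
  {E : Type*} [NormedAddCommGroup E] [NormedSpace ℝ E]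
  {M : Type*} [TopologicalSpace M] [ChartedSpace E M] {f : N → M}

theorem extChartAt_symm_mem_chart_source (he : e ∈ (extChartAt 𝓘(ℝ, F) x).target) :
    (extChartAt 𝓘(ℝ, F) x).symm e ∈ (chartAt F x).source := by
  simpa only [extChartAt_source] using (extChartAt 𝓘(ℝ, F) x).map_target he

theorem tendsto_extChartAt_symm (x : N) :
    Filter.Tendsto (extChartAt 𝓘(ℝ, F) x).symm (𝓝 (extChartAt 𝓘(ℝ, F) x x)) (𝓝 x) := by
  simpa only [extChartAt_to_inv] using (continuousAt_extChartAt_symm (I := 𝓘(ℝ, F)) x).tendsto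

theorem contDiffAt_writtenInExtChartAt (hf : ContMDiff 𝓘(ℝ, F) 𝓘(ℝ, E) ∞ f) (x : N) :
    ContDiffAt ℝ ∞ (writtenInExtChartAt 𝓘(ℝ, F) 𝓘(ℝ, E) x f) (extChartAt 𝓘(ℝ, F) x x) := by
  have h := (contMDiffAt_iff.1 (hf x)).2
  rwa [modelWithCornersSelf_coe, range_id, contDiffWithinAt_univ] at h

variable [IsManifold 𝓘(ℝ, F) ∞ N]

theorem coordMap_self (x : N) (v : TangentSpace 𝓘(ℝ, F) x) : coordMap x x v = v := by
  rw [coordMap, TangentBundle.continuousLinearMapAt_trivializationAt_eq_core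
    (mem_chart_source F x)]
  exact (tangentBundleCore 𝓘(ℝ, F) N).coordChange_self _ _ (mem_chart_source F x) v

theorem mfderiv_extChartAt_symm (he : e ∈ (extChartAt 𝓘(ℝ, F) x).target) (v : F) :
    mfderiv 𝓘(ℝ, F) 𝓘(ℝ, F) (extChartAt 𝓘(ℝ, F) x).symm e v
      = frameMap x ((extChartAt 𝓘(ℝ, F) x).symm e) v := by
  rw [frameMap, TangentBundle.symmL_trivializationAt (extChartAt_symm_mem_chart_source he),
    modelWithCornersSelf_coe, range_id, mfderivWithin_univ, (extChartAt 𝓘(ℝ, F) x).right_inv he]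
  rfl

theorem mpullbackWithin_extChartAt_symm (he : e ∈ (extChartAt 𝓘(ℝ, F) x).target)
    (X : ∀ y : N, TangentSpace 𝓘(ℝ, F) y) :
    VectorField.mpullbackWithin 𝓘(ℝ, F) 𝓘(ℝ, F) (extChartAt 𝓘(ℝ, F) x).symm X univ e
      = coordMap x ((extChartAt 𝓘(ℝ, F) x).symm e) (X ((extChartAt 𝓘(ℝ, F) x).symm e)) := by
  have hsource := extChartAt_symm_mem_chart_source he
  have hinverse : (mfderiv 𝓘(ℝ, F) 𝓘(ℝ, F) (extChartAt 𝓘(ℝ, F) x).symm e).inverse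
      = coordMap x ((extChartAt 𝓘(ℝ, F) x).symm e) :=
    ContinuousLinearMap.inverse_eq
      (ContinuousLinearMap.ext fun v =>
        (mfderiv_extChartAt_symm he _).trans (frameMap_coordMap hsource v))
      (ContinuousLinearMap.ext fun v =>
        (congrArg _ (mfderiv_extChartAt_symm he v)).trans (coordMap_frameMap hsource v))
  rw [VectorField.mpullbackWithin_apply, mfderivWithin_univ, hinverse]
  rfl

theorem coordMap_mlieBracket {X Y : ∀ y : N, TangentSpace 𝓘(ℝ, F) y}
    (hX : MDifferentiableAlongAt F (fun y : N => y) X x)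
    (hY : MDifferentiableAlongAt F (fun y : N => y) Y x) :
    coordMap x x (VectorField.mlieBracket 𝓘(ℝ, F) X Y x)
      = mvfderiv 𝓘(ℝ, F) (fun y => coordMap x y (Y y)) x (X x)
        - mvfderiv 𝓘(ℝ, F) (fun y => coordMap x y (X y)) x (Y x) := by
  have hpull : ∀ Z : ∀ y : N, TangentSpace 𝓘(ℝ, F) y,
      VectorField.mpullbackWithin 𝓘(ℝ, F) 𝓘(ℝ, F) (extChartAt 𝓘(ℝ, F) x).symm Z univ
        =ᶠ[𝓝 (extChartAt 𝓘(ℝ, F) x x)]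
          (fun y => coordMap x y (Z y)) ∘ (extChartAt 𝓘(ℝ, F) x).symm := fun Z => by
    filter_upwards [extChartAt_target_mem_nhds (I := 𝓘(ℝ, F)) x] with e he
    exact mpullbackWithin_extChartAt_symm he Z
  have hchart : mfderiv 𝓘(ℝ, F) 𝓘(ℝ, F) (extChartAt 𝓘(ℝ, F) x) x = coordMap x x :=
    (TangentBundle.continuousLinearMapAt_trivializationAt (mem_chart_source F x)).symm
  rw [mvfderiv_apply_eq_fderiv (mdifferentiableAlongAt_iff.1 hX).2,
    mvfderiv_apply_eq_fderiv (mdifferentiableAlongAt_iff.1 hY).2,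
    ← VectorField.mlieBracketWithin_univ, VectorField.mlieBracketWithin_apply, ← hchart]
  simp only [preimage_univ, univ_inter, modelWithCornersSelf_coe, range_id]
  have hinv := isInvertible_mfderiv_extChartAt (I := 𝓘(ℝ, F)) (mem_extChartAt_source x)
  refine (ContinuousLinearMap.IsInvertible.self_apply_inverse hinv _).trans
    ((congrFun (VectorField.lieBracketWithin_univ (E := F)) _).trans
      (((hpull X).lieBracket_vectorField_eq (hpull Y)).trans ?_))
  rw [VectorField.lieBracket, Function.comp_apply, Function.comp_apply, extChartAt_to_inv,
    coordMap_self, coordMap_self]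

variable [IsManifold 𝓘(ℝ, E) ∞ M]

variable (E F) in
/-- The Jacobian of `f` at `y`, in the charts at `x` and `f x`. -/
noncomputable def jacobian (f : N → M) (x y : N) : F →L[ℝ] E :=
  coordMap (f x) (f y) ∘L mfderiv 𝓘(ℝ, F) 𝓘(ℝ, E) f y ∘L frameMap x y

theorem coordMap_mfderiv {y : N} (hy : y ∈ (chartAt F x).source) (v : TangentSpace 𝓘(ℝ, F) y) :
    coordMap (f x) (f y) (mfderiv 𝓘(ℝ, F) 𝓘(ℝ, E) f y v) = jacobian F E f x y (coordMap x y v) := by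
  simp only [jacobian, ContinuousLinearMap.comp_apply, frameMap_coordMap hy]

theorem mfderiv_frameMap {y : N} (hy : f y ∈ (chartAt E (f x)).source) (e : F) :
    mfderiv 𝓘(ℝ, F) 𝓘(ℝ, E) f y (frameMap x y e) = frameMap (f x) (f y) (jacobian F E f x y e) := by
  simp only [jacobian, ContinuousLinearMap.comp_apply, frameMap_coordMap hy]

theorem jacobian_comp_extChartAt_symm (hf : ContMDiff 𝓘(ℝ, F) 𝓘(ℝ, E) ∞ f) (x : N) :
    jacobian F E f x ∘ (extChartAt 𝓘(ℝ, F) x).symm =ᶠ[𝓝 (extChartAt 𝓘(ℝ, F) x x)]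
      fderiv ℝ (writtenInExtChartAt 𝓘(ℝ, F) 𝓘(ℝ, E) x f) := by
  filter_upwards [extChartAt_target_mem_nhds (I := 𝓘(ℝ, F)) x,
    (tendsto_extChartAt_symm x).eventually
      (hf.continuous.continuousAt.eventually (chart_source_mem_nhds E (f x)))] with e he hse
  have hsymm := mdifferentiableWithinAt_extChartAt_symm he
  rw [modelWithCornersSelf_coe, range_id, mdifferentiableWithinAt_univ] at hsymm
  have hfe := hf.mdifferentiable (by simp) ((extChartAt 𝓘(ℝ, F) x).symm e)
  have hchart : MDifferentiableAt 𝓘(ℝ, E) 𝓘(ℝ, E) (extChartAt 𝓘(ℝ, E) (f x))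
      (f ((extChartAt 𝓘(ℝ, F) x).symm e)) := mdifferentiableAt_extChartAt hse
  ext v
  simp only [Function.comp_apply, jacobian, ContinuousLinearMap.comp_apply]
  rw [← mfderiv_extChartAt_symm he, coordMap,
    TangentBundle.continuousLinearMapAt_trivializationAt hse, ← mfderiv_eq_fderiv]
  have h₁ := mfderiv_comp_apply e hfe hsymm v
  have h₂ := mfderiv_comp_apply e hchart (hfe.comp e hsymm) v
  exact (h₂.trans (congrArg _ h₁)).symm

theorem contMDiffAt_jacobian (hf : ContMDiff 𝓘(ℝ, F) 𝓘(ℝ, E) ∞ f) (x : N) :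
    ContMDiffAt 𝓘(ℝ, F) 𝓘(ℝ, F →L[ℝ] E) ∞ (jacobian F E f x) x := by
  have hsmooth : ContMDiffAt 𝓘(ℝ, F) 𝓘(ℝ, F →L[ℝ] E) ∞
      (fderiv ℝ (writtenInExtChartAt 𝓘(ℝ, F) 𝓘(ℝ, E) x f) ∘ extChartAt 𝓘(ℝ, F) x) x :=
    ((contDiffAt_writtenInExtChartAt hf x).fderiv_right (m := ∞) le_rfl).contMDiffAt.comp x
      contMDiffAt_extChartAt
  refine hsmooth.congr_of_eventuallyEq ?_
  filter_upwards [(continuousAt_extChartAt (I := 𝓘(ℝ, F)) x).eventually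
    (jacobian_comp_extChartAt_symm hf x), extChartAt_source_mem_nhds (I := 𝓘(ℝ, F)) x] with y hy hys
  rwa [Function.comp_apply, (extChartAt 𝓘(ℝ, F) x).left_inv hys] at hy

theorem mvfderiv_jacobian_symm (hf : ContMDiff 𝓘(ℝ, F) 𝓘(ℝ, E) ∞ f)
    (u v : TangentSpace 𝓘(ℝ, F) x) :
    mvfderiv 𝓘(ℝ, F) (jacobian F E f x) x u (coordMap x x v)
      = mvfderiv 𝓘(ℝ, F) (jacobian F E f x) x v (coordMap x x u) := by
  have hdiff := (contMDiffAt_jacobian hf x).mdifferentiableAt (by simp)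
  rw [mvfderiv_apply_eq_fderiv hdiff, mvfderiv_apply_eq_fderiv hdiff,
    (jacobian_comp_extChartAt_symm hf x).fderiv_eq, coordMap_self, coordMap_self]
  exact (contDiffAt_writtenInExtChartAt hf x).isSymmSndFDerivAt
    (by simpa only [minSmoothness_of_isRCLikeNormedField] using ENat.LEInfty.out) u v

end CoordinateDerivative

section Submanifold

variable {E : Type*} [NormedAddCommGroup E] [NormedSpace ℝ E]
  {M : Type*} [TopologicalSpace M] [ChartedSpace E M]
  {F : Type*} [NormedAddCommGroup F] [NormedSpace ℝ F]
  {N : Type*} [TopologicalSpace N] [ChartedSpace F N]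
  {g : ∀ p : M, TangentSpace 𝓘(ℝ, E) p →L[ℝ] TangentSpace 𝓘(ℝ, E) p →L[ℝ] ℝ}
  {f : N → M} {x : N} {X Y : ∀ y : N, TangentSpace 𝓘(ℝ, F) y}

theorem inducedMetric_apply (u v : TangentSpace 𝓘(ℝ, F) x) :
    inducedMetric F g f x u v
      = g (f x) (mfderiv 𝓘(ℝ, F) 𝓘(ℝ, E) f x u) (mfderiv 𝓘(ℝ, F) 𝓘(ℝ, E) f x v) := rfl

variable [IsManifold 𝓘(ℝ, E) ∞ M] [IsManifold 𝓘(ℝ, F) ∞ N]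

theorem coordMap_mfderiv_eventuallyEq (Y : ∀ y : N, TangentSpace 𝓘(ℝ, F) y) :
    (fun y => coordMap (f x) (f y) (mfderiv 𝓘(ℝ, F) 𝓘(ℝ, E) f y (Y y))) =ᶠ[𝓝 x]
      fun y => jacobian F E f x y (coordMap x y (Y y)) := by
  filter_upwards [chart_source_mem_nhds F x] with y hy
  exact coordMap_mfderiv hy (Y y)

theorem MDifferentiableAlongAt.mfderiv_apply (hf : ContMDiff 𝓘(ℝ, F) 𝓘(ℝ, E) ∞ f)
    (hY : MDifferentiableAlongAt F (fun y : N => y) Y x) :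
    MDifferentiableAlongAt F f (fun y => mfderiv 𝓘(ℝ, F) 𝓘(ℝ, E) f y (Y y)) x :=
  mdifferentiableAlongAt_iff.2 ⟨hf.mdifferentiableAt (by simp),
    (((contMDiffAt_jacobian hf x).mdifferentiableAt (by simp)).clm_apply
      (mdifferentiableAlongAt_iff.1 hY).2).congr_of_eventuallyEq
        (coordMap_mfderiv_eventuallyEq Y)⟩

theorem mvfderiv_coordMap_mfderiv (hf : ContMDiff 𝓘(ℝ, F) 𝓘(ℝ, E) ∞ f)
    (hY : MDifferentiableAlongAt F (fun y : N => y) Y x) (v : TangentSpace 𝓘(ℝ, F) x) :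
    mvfderiv 𝓘(ℝ, F)
        (fun y => coordMap (f x) (f y) (mfderiv 𝓘(ℝ, F) 𝓘(ℝ, E) f y (Y y))) x v
      = mvfderiv 𝓘(ℝ, F) (jacobian F E f x) x v (coordMap x x (Y x))
        + jacobian F E f x x (mvfderiv 𝓘(ℝ, F) (fun y => coordMap x y (Y y)) x v) := by
  rw [mvfderiv_congr_of_eventuallyEq (coordMap_mfderiv_eventuallyEq Y),
    mvfderiv_clm_apply ((contMDiffAt_jacobian hf x).mdifferentiableAt (by simp))
      (mdifferentiableAlongAt_iff.1 hY).2]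

theorem IsSemiRiemannianMetric.covDerivAlong_mfderiv_sub (hg : IsSemiRiemannianMetric g)
    (hf : ContMDiff 𝓘(ℝ, F) 𝓘(ℝ, E) ∞ f)
    (hX : MDifferentiableAlongAt F (fun y : N => y) X x)
    (hY : MDifferentiableAlongAt F (fun y : N => y) Y x) :
    covDerivAlong g f (fun y => mfderiv 𝓘(ℝ, F) 𝓘(ℝ, E) f y (Y y)) x (X x)
        - covDerivAlong g f (fun y => mfderiv 𝓘(ℝ, F) 𝓘(ℝ, E) f y (X y)) x (Y x)
      = mfderiv 𝓘(ℝ, F) 𝓘(ℝ, E) f x (VectorField.mlieBracket 𝓘(ℝ, F) X Y x) := by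
  have hcont := hf.continuous.continuousAt (x := x)
  rw [covDerivAlong_eq hcont, covDerivAlong_eq hcont, mvfderiv_coordMap_mfderiv hf hX,
    mvfderiv_coordMap_mfderiv hf hY, mvfderiv_jacobian_symm hf,
    hg.christoffel_symm (mfderiv 𝓘(ℝ, F) 𝓘(ℝ, E) f x (X x)), add_sub_add_right_eq_sub, ← map_sub,
    add_sub_add_left_eq_sub, ← map_sub, ← coordMap_mlieBracket hX hY,
    ← coordMap_mfderiv (mem_chart_source F x), frameMap_coordMap_self]

theorem IsSemiRiemannianMetric.leviCivita_sub
    {h : ∀ y : N, TangentSpace 𝓘(ℝ, F) y →L[ℝ] TangentSpace 𝓘(ℝ, F) y →L[ℝ] ℝ}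
    (hh : IsSemiRiemannianMetric h)
    (hX : MDifferentiableAlongAt F (fun y : N => y) X x)
    (hY : MDifferentiableAlongAt F (fun y : N => y) Y x) :
    leviCivita h Y x (X x) - leviCivita h X x (Y x) = VectorField.mlieBracket 𝓘(ℝ, F) X Y x := by
  have hcont : ContinuousAt (fun y : N => y) x := continuousAt_id
  rw [leviCivita, leviCivita, covDerivAlong_eq hcont, covDerivAlong_eq hcont,
    show mfderiv 𝓘(ℝ, F) 𝓘(ℝ, F) (fun y : N => y) x = _ from mfderiv_id,
    ContinuousLinearMap.id_apply, ContinuousLinearMap.id_apply, hh.christoffel_symm (X x),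
    add_sub_add_right_eq_sub, ← map_sub, ← coordMap_mlieBracket hX hY, frameMap_coordMap_self]

theorem coordForm_inducedMetric {y : N} (hy : f y ∈ (chartAt E (f x)).source) :
    coordForm x y (inducedMetric F g f y)
      = (jacobian F E f x y).precomp ℝ ∘L coordForm (f x) (f y) (g (f y))
          ∘L jacobian F E f x y := by
  ext e e'
  rw [coordForm_apply, inducedMetric_apply, mfderiv_frameMap hy, mfderiv_frameMap hy]
  rfl

theorem IsNondegenerateSubmanifold.isSemiRiemannianMetric_inducedMetric
    (hN : IsNondegenerateSubmanifold F g f) (hg : IsSemiRiemannianMetric g) :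
    IsSemiRiemannianMetric (inducedMetric F g f) where
  contMDiff x := by
    have hjac := contMDiffAt_jacobian hN.contMDiff x
    have hform := ((contMDiffAt_form_iff (mem_chart_source E (f x))).1
      (hg.contMDiff (f x))).comp x (hN.contMDiff x)
    refine (contMDiffAt_form_iff (mem_chart_source F x)).2 <|
      ((hjac.clm_precomp (F₃ := ℝ)).clm_comp (hform.clm_comp hjac)).congr_of_eventuallyEq ?_
    filter_upwards [hN.contMDiff.continuous.continuousAt.eventually
      (chart_source_mem_nhds E (f x))] with y hy
    exact coordForm_inducedMetric hy
  symm _ _ _ := hg.symm _ _ _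
  nondegenerate := hN.nondegenerate

variable [FiniteDimensional ℝ E] [FiniteDimensional ℝ F]

theorem IsNondegenerateSubmanifold.inducedMetric_leviCivita
    (hN : IsNondegenerateSubmanifold F g f) (hg : IsSemiRiemannianMetric g)
    (hY : MDifferentiableAlongAt F (fun y : N => y) Y x) (v w : TangentSpace 𝓘(ℝ, F) x) :
    inducedMetric F g f x (leviCivita (inducedMetric F g f) Y x v) w
      = g (f x) (covDerivAlong g f (fun y => mfderiv 𝓘(ℝ, F) 𝓘(ℝ, E) f y (Y y)) x v)
          (mfderiv 𝓘(ℝ, F) 𝓘(ℝ, E) f x w) := by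
  have hh := hN.isSemiRiemannianMetric_inducedMetric hg
  -- The difference of the two sides is symmetric in `X, Y` and skew in `Y, Z`, so it vanishes.
  let T (X Y Z : ∀ y : N, TangentSpace 𝓘(ℝ, F) y) : ℝ :=
    inducedMetric F g f x (leviCivita (inducedMetric F g f) Y x (X x)) (Z x)
      - g (f x) (covDerivAlong g f (fun y => mfderiv 𝓘(ℝ, F) 𝓘(ℝ, E) f y (Y y)) x (X x))
          (mfderiv 𝓘(ℝ, F) 𝓘(ℝ, E) f x (Z x))
  have hsymm {X Y Z : ∀ y : N, TangentSpace 𝓘(ℝ, F) y}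
      (hX : MDifferentiableAlongAt F (fun y : N => y) X x)
      (hY : MDifferentiableAlongAt F (fun y : N => y) Y x) : T X Y Z = T Y X Z := by
    have hinner := hh.leviCivita_sub hX hY
    have houter := hg.covDerivAlong_mfderiv_sub hN.contMDiff hX hY
    rw [← hinner, map_sub, sub_eq_sub_iff_add_eq_add] at houter
    have hpaired := congrArg (fun u => g (f x) u (mfderiv 𝓘(ℝ, F) 𝓘(ℝ, E) f x (Z x))) houter
    simp only [map_add, add_apply, ← inducedMetric_apply] at hpaired
    simp only [T]
    linarith
  have hskew {X Y Z : ∀ y : N, TangentSpace 𝓘(ℝ, F) y}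
      (hY : MDifferentiableAlongAt F (fun y : N => y) Y x)
      (hZ : MDifferentiableAlongAt F (fun y : N => y) Z x) : T X Y Z = -T X Z Y := by
    have hinner := hh.mvfderiv_apply_apply_eq_covDerivAlong hY hZ (X x)
    have houter := hg.mvfderiv_apply_apply_eq_covDerivAlong
      (hY.mfderiv_apply hN.contMDiff) (hZ.mfderiv_apply hN.contMDiff) (X x)
    have hcompare := hinner.symm.trans houter
    rw [hh.symm _ (Y x), hg.symm _ (mfderiv 𝓘(ℝ, F) 𝓘(ℝ, E) f x (Y x))] at hcompare
    simp only [T, leviCivita]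
    linarith
  have hv := mdifferentiableAlongAt_coordField x v
  have hw := mdifferentiableAlongAt_coordField x w
  have hzero : T (coordField x v) Y (coordField x w) = 0 := by
    linarith [hsymm (Z := coordField x w) hv hY, hskew (X := Y) hv hw,
      hsymm (Z := coordField x v) hY hw, hskew (X := coordField x w) hY hv,
      hsymm (Z := Y) hw hv, hskew (X := coordField x v) hw hY]
  simpa only [T, coordField_self, sub_eq_zero] using hzero

end Submanifold

section Endomorphism

variable {E : Type*} [NormedAddCommGroup E] [NormedSpace ℝ E]
  {M : Type*} [TopologicalSpace M] [ChartedSpace E M] [IsManifold 𝓘(ℝ, E) ∞ M]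
  {F : Type*} [NormedAddCommGroup F] [NormedSpace ℝ F]
  {N : Type*} [TopologicalSpace N] [ChartedSpace F N]
  {g : ∀ p : M, TangentSpace 𝓘(ℝ, E) p →L[ℝ] TangentSpace 𝓘(ℝ, E) p →L[ℝ] ℝ}
  {S : ∀ p : M, TangentSpace 𝓘(ℝ, E) p →L[ℝ] TangentSpace 𝓘(ℝ, E) p}
  {U : Set M} {p q : M} {φ : N → M} {x : N} {V : ∀ y : N, TangentSpace 𝓘(ℝ, E) (φ y)}

/-- The matrix of the endomorphism `A` of `T_q M` in the chart at `p`. -/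
noncomputable def coordEnd (p q : M) (A : TangentSpace 𝓘(ℝ, E) q →L[ℝ] TangentSpace 𝓘(ℝ, E) q) :
    E →L[ℝ] E :=
  coordMap p q ∘L A ∘L frameMap p q

theorem coordMap_apply_eq_coordEnd (hq : q ∈ (chartAt E p).source)
    (A : TangentSpace 𝓘(ℝ, E) q →L[ℝ] TangentSpace 𝓘(ℝ, E) q) (u : TangentSpace 𝓘(ℝ, E) q) :
    coordMap p q (A u) = coordEnd p q A (coordMap p q u) := by
  simp only [coordEnd, ContinuousLinearMap.comp_apply, frameMap_coordMap hq]

theorem IsSmoothEndOn.contMDiffAt_coordEnd (hS : IsSmoothEndOn S U) (hU : IsOpen U) (hp : p ∈ U) :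
    ContMDiffAt 𝓘(ℝ, E) 𝓘(ℝ, E →L[ℝ] E) ∞ (fun q => coordEnd p q (S q)) p :=
  ((contMDiffAt_hom_bundle _).1 (hS.contMDiffAt (hU.mem_nhds hp))).2

theorem coordMap_apply_eventuallyEq (hφ : ContinuousAt φ x) :
    (fun y => coordMap (φ x) (φ y) (S (φ y) (V y))) =ᶠ[𝓝 x]
      fun y => coordEnd (φ x) (φ y) (S (φ y)) (coordMap (φ x) (φ y) (V y)) := by
  filter_upwards [hφ.eventually (chart_source_mem_nhds E (φ x))] with y hy
  exact coordMap_apply_eq_coordEnd hy _ _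

variable (g S) in
/-- The endomorphism `∇_a S` of `T_p M`, for `a ∈ T_p M`, evaluated at `u`. -/
noncomputable def covDerivEnd (p : M) (a u : TangentSpace 𝓘(ℝ, E) p) : TangentSpace 𝓘(ℝ, E) p :=
  frameMap p p (mvfderiv 𝓘(ℝ, E) (fun q => coordEnd p q (S q)) p a (coordMap p p u))
    + christoffel g p a (S p u) - S p (christoffel g p a u)

namespace IsSmoothEndOn

theorem mdifferentiableAt_coordEnd_comp (hS : IsSmoothEndOn S U) (hU : IsOpen U) (hx : φ x ∈ U)
    (hφ : MDifferentiableAt 𝓘(ℝ, F) 𝓘(ℝ, E) φ x) :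
    MDifferentiableAt 𝓘(ℝ, F) 𝓘(ℝ, E →L[ℝ] E)
      (fun y => coordEnd (φ x) (φ y) (S (φ y))) x :=
  ((hS.contMDiffAt_coordEnd hU hx).mdifferentiableAt (by simp)).comp x hφ

theorem mdifferentiableAlongAt_apply (hS : IsSmoothEndOn S U) (hU : IsOpen U) (hx : φ x ∈ U)
    (hV : MDifferentiableAlongAt F φ V x) :
    MDifferentiableAlongAt F φ (fun y => S (φ y) (V y)) x := by
  obtain ⟨hφ, hV⟩ := mdifferentiableAlongAt_iff.1 hV
  exact mdifferentiableAlongAt_iff.2 ⟨hφ,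
    ((hS.mdifferentiableAt_coordEnd_comp hU hx hφ).clm_apply hV).congr_of_eventuallyEq
      (coordMap_apply_eventuallyEq hφ.continuousAt)⟩

theorem covDerivAlong_apply (hS : IsSmoothEndOn S U) (hU : IsOpen U) (hx : φ x ∈ U)
    (hV : MDifferentiableAlongAt F φ V x) (v : TangentSpace 𝓘(ℝ, F) x) :
    covDerivAlong g φ (fun y => S (φ y) (V y)) x v
      = covDerivEnd g S (φ x) (mfderiv 𝓘(ℝ, F) 𝓘(ℝ, E) φ x v) (V x)
        + S (φ x) (covDerivAlong g φ V x v) := by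
  obtain ⟨hφ, hV⟩ := mdifferentiableAlongAt_iff.1 hV
  have hderiv : mvfderiv 𝓘(ℝ, F) (fun y => coordEnd (φ x) (φ y) (S (φ y))) x v
      = mvfderiv 𝓘(ℝ, E) (fun q => coordEnd (φ x) q (S q)) (φ x)
          (mfderiv 𝓘(ℝ, F) 𝓘(ℝ, E) φ x v) :=
    mfderiv_comp_apply x ((hS.contMDiffAt_coordEnd hU hx).mdifferentiableAt (by simp)) hφ v
  have hframe : ∀ e : E, frameMap (φ x) (φ x) (coordEnd (φ x) (φ x) (S (φ x)) e)
      = S (φ x) (frameMap (φ x) (φ x) e) := fun e => frameMap_coordMap_self _ _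
  rw [covDerivAlong_eq hφ.continuousAt, covDerivAlong_eq hφ.continuousAt,
    mvfderiv_congr_of_eventuallyEq (coordMap_apply_eventuallyEq hφ.continuousAt),
    mvfderiv_clm_apply (hS.mdifferentiableAt_coordEnd_comp hU hx hφ) hV, hderiv, covDerivEnd]
  simp only [map_add, hframe]
  abel

end IsSmoothEndOn

theorem contMDiffAt_coordField (p : M) (v : TangentSpace 𝓘(ℝ, E) p) :
    ContMDiffAt 𝓘(ℝ, E) 𝓘(ℝ, E).tangent ∞
      (fun q => (TotalSpace.mk' E q (coordField p v q) : TangentBundle 𝓘(ℝ, E) M)) p := by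
  refine (contMDiffAt_vectorField_iff (mem_chart_source E p)).2 <|
    (contMDiffAt_const (c := coordMap p p v)).congr_of_eventuallyEq ?_
  filter_upwards [chart_source_mem_nhds E p] with q hq
  rw [coordField_eq_frameMap hq, coordMap_frameMap hq]

/-- `S` is a smooth section of `σ ⊆ End(TM)` over the open set `U`. -/
structure IsLocalSection
    (σ : ∀ p : M, Submodule ℝ (TangentSpace 𝓘(ℝ, E) p →L[ℝ] TangentSpace 𝓘(ℝ, E) p))
    (U : Set M) (S : ∀ p : M, TangentSpace 𝓘(ℝ, E) p →L[ℝ] TangentSpace 𝓘(ℝ, E) p) : Prop where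
  isOpen : IsOpen U
  smooth : IsSmoothEndOn S U
  mem : ∀ p ∈ U, S p ∈ σ p

variable {σ : ∀ p : M, Submodule ℝ (TangentSpace 𝓘(ℝ, E) p →L[ℝ] TangentSpace 𝓘(ℝ, E) p)}

theorem IsCanonicalLocalBasis.isLocalSection
    {J : Fin 3 → ∀ p : M, TangentSpace 𝓘(ℝ, E) p →L[ℝ] TangentSpace 𝓘(ℝ, E) p}
    (hJ : IsCanonicalLocalBasis σ U J) (α : Fin 3) : IsLocalSection σ U (J α) where
  isOpen := hJ.isOpen
  smooth := hJ.smooth α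
  mem p hp := hJ.span_eq p hp ▸ Submodule.subset_span (mem_range_self α)

theorem IsParaquaternionicKahler.exists_covDerivEnd_eq (hM : IsParaquaternionicKahler g σ)
    (hS : IsLocalSection σ U S) (hp : p ∈ U) (a : TangentSpace 𝓘(ℝ, E) p) :
    ∃ T ∈ σ p, ∀ u, covDerivEnd g S p a u = T u := by
  obtain ⟨T, hT, hparallel⟩ := hM.parallel U S hS.isOpen hS.smooth hS.mem p hp a
  refine ⟨T, hT, fun u => ?_⟩
  have hproduct := hS.smooth.covDerivAlong_apply (g := g) (φ := fun q : M => q) hS.isOpen hp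
    (mdifferentiableAlongAt_coordField p u) a
  have hself : mfderiv 𝓘(ℝ, E) 𝓘(ℝ, E) (fun q : M => q) p = .id ℝ _ := mfderiv_id
  rw [← coordField_self p u, ← hparallel _ (contMDiffAt_coordField p u), leviCivita, hproduct,
    add_sub_assoc, leviCivita, sub_self, add_zero, hself, coordField_self,
    ContinuousLinearMap.id_apply]

end Endomorphism

section OrthogonalComplement

variable {V : Type*} [AddCommGroup V] [Module ℝ V] [TopologicalSpace V] {b : V →L[ℝ] V →L[ℝ] ℝ}

theorem mem_orthCompl_span_range_iff {ι : Type*} {X : ι → V} {u : V} :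
    u ∈ orthCompl b (Submodule.span ℝ (range X)) ↔ ∀ i, b (X i) u = 0 := by
  refine ⟨fun hu i => hu _ (Submodule.subset_span (mem_range_self i)), fun hu w hw => ?_⟩
  have hle : Submodule.span ℝ (range X) ≤ (b.toBilinForm.flip u).ker :=
    Submodule.span_le.2 (range_subset_iff.2 hu)
  exact hle hw

variable [FiniteDimensional ℝ V]

theorem surjective_pi_of_linearIndependent (hsymm : ∀ u v, b u v = b v u)
    (hb : ∀ u, (∀ v, b u v = 0) → u = 0) {ι : Type*} {X : ι → V} (hX : LinearIndependent ℝ X) :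
    Function.Surjective fun (v : V) (i : ι) => b (X i) v := fun a => by
  obtain ⟨ℓ, hℓ⟩ := LinearMap.exists_extend ((Module.Basis.span hX).constr ℝ a)
  refine ⟨sharp b ℓ, funext fun i => ?_⟩
  have hvalue := LinearMap.congr_fun hℓ (Module.Basis.span hX i)
  rw [Module.Basis.constr_basis, LinearMap.comp_apply, Submodule.subtype_apply,
    Module.Basis.span_apply] at hvalue
  exact (hsymm _ _).trans ((sharp_spec b hb ℓ _).trans hvalue)

theorem orthCompl_orthCompl [IsTopologicalAddGroup V] [ContinuousSMul ℝ V]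
    (hsymm : ∀ u v, b u v = b v u) (hb : ∀ u, (∀ v, b u v = 0) → u = 0) (W : Submodule ℝ V) :
    orthCompl b (orthCompl b W) = W := by
  have hrefl : b.toBilinForm.IsRefl := fun u v h => (hsymm v u).trans h
  have hnondeg : b.toBilinForm.Nondegenerate :=
    ⟨hb, fun u hu => hb u fun v => (hsymm u v).trans (hu v)⟩
  exact LinearMap.BilinForm.orthogonal_orthogonal hnondeg hrefl W

end OrthogonalComplement

section Distributions

variable {F : Type*} [NormedAddCommGroup F] [NormedSpace ℝ F]
  {N : Type*} [TopologicalSpace N] [ChartedSpace F N]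
  {x : N}

section AlongMap

variable {E : Type*} [NormedAddCommGroup E] [NormedSpace ℝ E]
  {M : Type*} [TopologicalSpace M] [ChartedSpace E M] [IsManifold 𝓘(ℝ, E) ∞ M]
  {f : N → M} {V : ∀ y : N, TangentSpace 𝓘(ℝ, E) (f y)}

theorem contMDiffAt_along_iff :
    ContMDiffAt 𝓘(ℝ, F) 𝓘(ℝ, E).tangent ∞
        (fun y => (TotalSpace.mk' E (f y) (V y) : TangentBundle 𝓘(ℝ, E) M)) x ↔
      ContMDiffAt 𝓘(ℝ, F) 𝓘(ℝ, E) ∞ f x ∧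
        ContMDiffAt 𝓘(ℝ, F) 𝓘(ℝ, E) ∞ (fun y => coordMap (f x) (f y) (V y)) x := by
  rw [contMDiffAt_totalSpace]
  exact and_congr_right fun hf =>
    (trivializationAt_snd_eventuallyEq hf.continuousAt V).contMDiffAt_iff

theorem exists_isSectionAlong_eq [FiniteDimensional ℝ F] [T2Space N] [IsManifold 𝓘(ℝ, F) ∞ N]
    (hf : ContMDiff 𝓘(ℝ, F) 𝓘(ℝ, E) ∞ f)
    {W : ∀ y : N, Submodule ℝ (TangentSpace 𝓘(ℝ, E) (f y))} {U : Set N} (hU : IsOpen U)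
    (hx : x ∈ U)
    (hV : ContMDiffOn 𝓘(ℝ, F) 𝓘(ℝ, E).tangent ∞
      (fun y => (TotalSpace.mk' E (f y) (V y) : TangentBundle 𝓘(ℝ, E) M)) U)
    (hVW : ∀ y ∈ U, V y ∈ W y) : ∃ ξ, IsSectionAlong F f W ξ ∧ ξ x = V x := by
  obtain ⟨χ, -, hχ⟩ :=
    (SmoothBumpFunction.nhds_basis_tsupport (I := 𝓘(ℝ, F)) x).mem_iff.1 (hU.mem_nhds hx)
  refine ⟨fun y => χ y • V y, ⟨fun y => contMDiffAt_along_iff.2 ⟨hf y, ?_⟩, fun y => ?_⟩, ?_⟩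
  · simp only [map_smul]
    by_cases hy : y ∈ tsupport χ
    · exact χ.contMDiffAt.smul
        (contMDiffAt_along_iff.1 (hV.contMDiffAt (hU.mem_nhds (hχ hy)))).2
    · refine (contMDiffAt_const (c := (0 : E))).congr_of_eventuallyEq ?_
      filter_upwards [(isClosed_tsupport χ).isOpen_compl.mem_nhds hy] with z hz
      rw [image_eq_zero_of_notMem_tsupport hz, zero_smul]
  · by_cases hy : y ∈ tsupport χ
    · exact (W y).smul_mem _ (hVW y (hχ hy))
    · simp only [image_eq_zero_of_notMem_tsupport hy, zero_smul, zero_mem]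
  · exact (congrArg (· • V x) χ.eq_one).trans (one_smul ℝ (V x))

end AlongMap

theorem contMDiffAt_pi_clm [FiniteDimensional ℝ F] {ι : Type*} [Fintype ι]
    {A : N → ι → F →L[ℝ] ℝ}
    (hA : ∀ i, ContMDiffAt 𝓘(ℝ, F) 𝓘(ℝ, F →L[ℝ] ℝ) ∞ (fun y => A y i) x) :
    ContMDiffAt 𝓘(ℝ, F) 𝓘(ℝ, F →L[ℝ] ι → ℝ) ∞ (fun y => ContinuousLinearMap.pi (A y)) x := by
  have hpi : ContDiff ℝ ∞ fun B : ι → F →L[ℝ] ℝ => ContinuousLinearMap.pi B :=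
    contDiff_clm_apply_iff.2 fun _ => contDiff_pi.2 fun i =>
      (contDiff_apply ℝ (F →L[ℝ] ℝ) i).clm_apply contDiff_const
  exact hpi.contMDiff.contMDiffAt.comp x (contMDiffAt_pi_space.2 hA)

variable [IsManifold 𝓘(ℝ, F) ∞ N] {k : ℕ} {D : ∀ y : N, Submodule ℝ (TangentSpace 𝓘(ℝ, F) y)}

theorem IsSection.mdifferentiableAlongAt {X : ∀ y : N, TangentSpace 𝓘(ℝ, F) y}
    (hX : IsSection D X) (x : N) : MDifferentiableAlongAt F (fun y : N => y) X x :=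
  (hX.1 x).mdifferentiableAt (by simp)

theorem mem_span_range_frameMap_iff {y : N} (hy : y ∈ (chartAt F x).source) {ι : Type*} {e : ι → F}
    {v : TangentSpace 𝓘(ℝ, F) y} :
    v ∈ Submodule.span ℝ (range fun i => frameMap x y (e i)) ↔
      coordMap x y v ∈ Submodule.span ℝ (range e) := by
  have hrange : range (fun i => frameMap x y (e i)) = (frameMap x y).toLinearMap '' range e :=
    range_comp _ e
  rw [hrange, ← Submodule.map_span]
  constructor
  · rintro ⟨w, hw, rfl⟩
    rwa [ContinuousLinearMap.coe_coe, coordMap_frameMap hy]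
  · exact fun hv => ⟨coordMap x y v, hv, frameMap_coordMap hy v⟩

variable [FiniteDimensional ℝ F]

theorem IsSmoothDistribution.exists_isSection_eq [T2Space N] (hD : IsSmoothDistribution k D)
    {u : TangentSpace 𝓘(ℝ, F) x} (hu : u ∈ D x) : ∃ X, IsSection D X ∧ X x = u := by
  obtain ⟨U, hU, hx, X, hX, hspan⟩ := hD x
  rw [← (hspan x hx).2, Submodule.mem_span_range_iff_exists_fun] at hu
  obtain ⟨c, rfl⟩ := hu
  refine exists_isSectionAlong_eq (f := fun y : N => y) (V := fun y => ∑ i, c i • X i y)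
    contMDiff_id hU hx
    (ContMDiffOn.sum_section fun i _ => ContMDiffOn.const_smul_section (hX i)) fun y hy => ?_
  rw [← (hspan y hy).2]
  exact Submodule.sum_mem _ fun i _ =>
    Submodule.smul_mem _ _ (Submodule.subset_span (mem_range_self i))

theorem exists_smooth_basis_of_forall_mem_iff_ker {G : Type*} [NormedAddCommGroup G]
    [NormedSpace ℝ G] [FiniteDimensional ℝ G] {A : N → F →L[ℝ] G} {U : Set N} (hU : IsOpen U)
    (hx : x ∈ U) (hUx : U ⊆ (chartAt F x).source)
    (hA_smooth : ∀ y ∈ U, ContMDiffAt 𝓘(ℝ, F) 𝓘(ℝ, F →L[ℝ] G) ∞ A y)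
    (hA_surj : Function.Surjective (A x))
    (hDA : ∀ y ∈ U, ∀ v, v ∈ D y ↔ A y (coordMap x y v) = 0) :
    ∃ O : Set N, IsOpen O ∧ x ∈ O ∧
      ∃ X : Fin (Module.finrank ℝ F - Module.finrank ℝ G) → ∀ y : N, TangentSpace 𝓘(ℝ, F) y,
        (∀ i, ContMDiffOn 𝓘(ℝ, F) 𝓘(ℝ, F).tangent ∞
          (fun y => (TotalSpace.mk' F y (X i y) : TangentBundle 𝓘(ℝ, F) N)) O) ∧
        ∀ y ∈ O, LinearIndependent ℝ (fun i => X i y) ∧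
          Submodule.span ℝ (range fun i => X i y) = D y := by
  obtain ⟨W, hW, hxW, s, hs, hker⟩ := exists_contDiffOn_basis_ker hA_surj
  have hW_nhds : ∀ᶠ y in 𝓝 x, A y ∈ W :=
    (hA_smooth x hx).continuousAt.eventually (hW.mem_nhds hxW)
  obtain ⟨O, hO, hO_open, hxO⟩ := mem_nhds_iff.1 (hW_nhds.and (hU.mem_nhds hx))
  refine ⟨O, hO_open, hxO, fun j y => frameMap x y (s j (A y)), fun j y hy => ?_, fun y hy => ?_⟩
  · obtain ⟨hyW, hyU⟩ := hO hy
    refine ContMDiffAt.contMDiffWithinAt <| (contMDiffAt_vectorField_iff (hUx hyU)).2 <|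
      (((hs j).contDiffAt (hW.mem_nhds hyW)).contMDiffAt.comp y
        (hA_smooth y hyU)).congr_of_eventuallyEq ?_
    filter_upwards [(chartAt F x).open_source.mem_nhds (hUx hyU)] with z hz
    exact coordMap_frameMap hz _
  · obtain ⟨hyW, hyU⟩ := hO hy
    obtain ⟨hindep, hspan⟩ := hker (A y) hyW
    refine ⟨hindep.map_injOn (frameMap x y).toLinearMap
      (Function.LeftInverse.injective (coordMap_frameMap (hUx hyU))).injOn, ?_⟩
    ext v
    rw [mem_span_range_frameMap_iff (hUx hyU), hspan, hDA y hyU]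
    rfl

theorem IsSemiRiemannianMetric.isSmoothDistribution_orthCompl
    {h : ∀ y : N, TangentSpace 𝓘(ℝ, F) y →L[ℝ] TangentSpace 𝓘(ℝ, F) y →L[ℝ] ℝ}
    (hh : IsSemiRiemannianMetric h) (hD : IsSmoothDistribution k D) :
    IsSmoothDistribution (Module.finrank ℝ F - k) fun y => orthCompl (h y) (D y) := by
  intro x
  have : FiniteDimensional ℝ (TangentSpace 𝓘(ℝ, F) x) := ‹FiniteDimensional ℝ F›
  obtain ⟨U, hU, hx, X, hX, hspan⟩ := hD x
  let A (y : N) : F →L[ℝ] (Fin k → ℝ) :=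
    ContinuousLinearMap.pi fun i => coordForm x y (h y) (coordMap x y (X i y))
  have hA_apply : ∀ y ∈ (chartAt F x).source, ∀ v,
      A y (coordMap x y v) = fun i => h y (X i y) v :=
    fun y hy v => funext fun i => (apply_eq_coordForm hy (h y) (X i y) v).symm
  have hA_smooth : ∀ y ∈ U ∩ (chartAt F x).source,
      ContMDiffAt 𝓘(ℝ, F) 𝓘(ℝ, F →L[ℝ] (Fin k → ℝ)) ∞ A y := fun y hy =>
    contMDiffAt_pi_clm fun i => ((contMDiffAt_form_iff hy.2).1 (hh.contMDiff y)).clm_apply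
      ((contMDiffAt_vectorField_iff hy.2).1 ((hX i).contMDiffAt (hU.mem_nhds hy.1)))
  have hA_surj : Function.Surjective (A x) := fun a => by
    obtain ⟨v, hv⟩ := surjective_pi_of_linearIndependent (hh.symm x) (hh.nondegenerate x)
      (hspan x hx).1 a
    exact ⟨coordMap x x v, (hA_apply x (mem_chart_source F x) v).trans hv⟩
  have hDA : ∀ y ∈ U ∩ (chartAt F x).source, ∀ v,
      v ∈ orthCompl (h y) (D y) ↔ A y (coordMap x y v) = 0 := fun y hy v => by
    rw [← (hspan y hy.1).2, mem_orthCompl_span_range_iff, hA_apply y hy.2, funext_iff]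
    rfl
  have hframe := exists_smooth_basis_of_forall_mem_iff_ker (hU.inter (chartAt F x).open_source)
    ⟨hx, mem_chart_source F x⟩ inter_subset_right hA_smooth hA_surj hDA
  rwa [Module.finrank_fin_fun] at hframe

end Distributions

section SecondFundamentalForm

variable {E : Type*} [NormedAddCommGroup E] [NormedSpace ℝ E]
  {M : Type*} [TopologicalSpace M] [ChartedSpace E M]
  {F : Type*} [NormedAddCommGroup F] [NormedSpace ℝ F]
  {N : Type*} [TopologicalSpace N] [ChartedSpace F N]
  {g : ∀ p : M, TangentSpace 𝓘(ℝ, E) p →L[ℝ] TangentSpace 𝓘(ℝ, E) p →L[ℝ] ℝ}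
  {f : N → M} {x : N}

theorem IsNondegenerateSubmanifold.inducedMetric_tangentialPart [FiniteDimensional ℝ F]
    (hN : IsNondegenerateSubmanifold F g f) (w : TangentSpace 𝓘(ℝ, E) (f x))
    (v : TangentSpace 𝓘(ℝ, F) x) :
    inducedMetric F g f x (tangentialPart F g f x w) v
      = g (f x) w (mfderiv 𝓘(ℝ, F) 𝓘(ℝ, E) f x v) := by
  have : FiniteDimensional ℝ (TangentSpace 𝓘(ℝ, F) x) := ‹FiniteDimensional ℝ F›
  exact sharp_spec (inducedMetric F g f x) (hN.nondegenerate x)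
    (g (f x) w ∘L mfderiv 𝓘(ℝ, F) 𝓘(ℝ, E) f x).toLinearMap v

variable [IsManifold 𝓘(ℝ, E) ∞ M] {n : TangentSpace 𝓘(ℝ, E) (f x)}

theorem IsSemiRiemannianMetric.apply_mfderiv_of_mem_normalSpace (hg : IsSemiRiemannianMetric g)
    (hn : n ∈ normalSpace F g f x) (v : TangentSpace 𝓘(ℝ, F) x) :
    g (f x) n (mfderiv 𝓘(ℝ, F) 𝓘(ℝ, E) f x v) = 0 :=
  (hg.symm _ _ _).trans (hn _ ⟨v, rfl⟩)

theorem IsSemiRiemannianMetric.apply_normalPart (hg : IsSemiRiemannianMetric g)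
    (hn : n ∈ normalSpace F g f x) (w : TangentSpace 𝓘(ℝ, E) (f x)) :
    g (f x) n (normalPart F g f x w) = g (f x) n w := by
  rw [normalPart, map_sub, hg.apply_mfderiv_of_mem_normalSpace hn, sub_zero]

variable {X Y : ∀ y : N, TangentSpace 𝓘(ℝ, F) y}

theorem IsSemiRiemannianMetric.apply_secondFundamentalForm (hg : IsSemiRiemannianMetric g)
    (hn : n ∈ normalSpace F g f x) :
    g (f x) n (secondFundamentalForm g f X Y x)
      = g (f x) n
          (covDerivAlong g f (fun y => mfderiv 𝓘(ℝ, F) 𝓘(ℝ, E) f y (Y y)) x (X x)) :=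
  hg.apply_normalPart hn _

namespace IsNondegenerateSubmanifold

variable [FiniteDimensional ℝ F]

theorem normalPart_mem (hN : IsNondegenerateSubmanifold F g f) (hg : IsSemiRiemannianMetric g)
    (w : TangentSpace 𝓘(ℝ, E) (f x)) : normalPart F g f x w ∈ normalSpace F g f x := by
  rintro _ ⟨v, rfl⟩
  have htangential := hN.inducedMetric_tangentialPart w v
  rw [inducedMetric_apply] at htangential
  rw [hg.symm, normalPart, map_sub, sub_apply, ContinuousLinearMap.coe_coe, htangential, sub_self]

theorem eq_zero_of_mem_normalSpace (hN : IsNondegenerateSubmanifold F g f)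
    (hg : IsSemiRiemannianMetric g) (hn : n ∈ normalSpace F g f x)
    (horth : ∀ m ∈ normalSpace F g f x, g (f x) m n = 0) : n = 0 :=
  hg.nondegenerate _ n fun w => by
    rw [← hg.apply_normalPart hn, hg.symm, horth _ (hN.normalPart_mem hg w)]

variable [IsManifold 𝓘(ℝ, F) ∞ N]

theorem secondFundamentalForm_symm (hN : IsNondegenerateSubmanifold F g f)
    (hg : IsSemiRiemannianMetric g) (hX : MDifferentiableAlongAt F (fun y : N => y) X x)
    (hY : MDifferentiableAlongAt F (fun y : N => y) Y x) :
    secondFundamentalForm g f X Y x = secondFundamentalForm g f Y X x := by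
  refine sub_eq_zero.1 (hN.eq_zero_of_mem_normalSpace hg
    (sub_mem (hN.normalPart_mem hg _) (hN.normalPart_mem hg _)) fun m hm => ?_)
  rw [map_sub, hg.apply_secondFundamentalForm hm, hg.apply_secondFundamentalForm hm, ← map_sub,
    hg.covDerivAlong_mfderiv_sub hN.contMDiff hX hY, hg.apply_mfderiv_of_mem_normalSpace hm]

theorem inducedMetric_shapeOperator [FiniteDimensional ℝ E]
    (hN : IsNondegenerateSubmanifold F g f) (hg : IsSemiRiemannianMetric g)
    {ξ : ∀ y : N, TangentSpace 𝓘(ℝ, E) (f y)} (hξ : MDifferentiableAlongAt F f ξ x)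
    (hξ_normal : ∀ y, ξ y ∈ normalSpace F g f y)
    (hY : MDifferentiableAlongAt F (fun y : N => y) Y x) :
    inducedMetric F g f x (shapeOperator g f ξ X x) (Y x)
      = g (f x) (ξ x) (secondFundamentalForm g f X Y x) := by
  have hderiv := hg.covDerivAlong_orthogonal hξ (hY.mfderiv_apply hN.contMDiff)
    (.of_forall fun y => hg.apply_mfderiv_of_mem_normalSpace (hξ_normal y) (Y y)) (X x)
  rw [shapeOperator, map_neg, neg_apply, hN.inducedMetric_tangentialPart, hderiv, neg_neg,
    hg.apply_secondFundamentalForm (hξ_normal x)]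

end IsNondegenerateSubmanifold

end SecondFundamentalForm

section CRSubmanifolds

variable {E : Type*} [NormedAddCommGroup E] [NormedSpace ℝ E]
  {M : Type*} [TopologicalSpace M] [ChartedSpace E M]
  {F : Type*} [NormedAddCommGroup F] [NormedSpace ℝ F]
  {N : Type*} [TopologicalSpace N] [ChartedSpace F N]
  {g : ∀ p : M, TangentSpace 𝓘(ℝ, E) p →L[ℝ] TangentSpace 𝓘(ℝ, E) p →L[ℝ] ℝ}
  {σ : ∀ p : M, Submodule ℝ (TangentSpace 𝓘(ℝ, E) p →L[ℝ] TangentSpace 𝓘(ℝ, E) p)}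
  {f : N → M} {D : ∀ x : N, Submodule ℝ (TangentSpace 𝓘(ℝ, F) x)} {x : N}
  {S : ∀ p : M, TangentSpace 𝓘(ℝ, E) p →L[ℝ] TangentSpace 𝓘(ℝ, E) p} {U : Set M}
  {J : Fin 3 → ∀ p : M, TangentSpace 𝓘(ℝ, E) p →L[ℝ] TangentSpace 𝓘(ℝ, E) p}

theorem pqSign_ne_zero (α : Fin 3) : pqSign α ≠ 0 := by
  fin_cases α <;> simp [pqSign]

theorem apply_mfderiv_mem_nuPerp {T : TangentSpace 𝓘(ℝ, E) (f x) →L[ℝ] TangentSpace 𝓘(ℝ, E) (f x)}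
    (hT : T ∈ σ (f x)) {u : TangentSpace 𝓘(ℝ, F) x} (hu : u ∈ distPerp g f D x) :
    T (mfderiv 𝓘(ℝ, F) 𝓘(ℝ, E) f x u) ∈ nuPerp g σ f D x :=
  Submodule.mem_iSup_of_mem T (Submodule.mem_iSup_of_mem hT ⟨_, ⟨u, hu, rfl⟩, rfl⟩)

variable [IsManifold 𝓘(ℝ, E) ∞ M]

namespace IsAlmostParaquaternionicHermitian

theorem apply_canonicalLocalBasis (hM : IsAlmostParaquaternionicHermitian g σ)
    (hJ : IsCanonicalLocalBasis σ U J) {p : M} (hp : p ∈ U) (α : Fin 3)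
    (u v : TangentSpace 𝓘(ℝ, E) p) : g p (J α p u) v = -g p u (J α p v) := by
  have hsq : J α p (J α p v) = -pqSign α • v := congrArg (· v) (hJ.sq p hp α)
  have hadapted := hM.adapted U J hJ p hp α u (J α p v)
  rw [hsq, map_smul, smul_eq_mul, neg_mul, ← mul_neg] at hadapted
  linarith [mul_left_cancel₀ (pqSign_ne_zero α) hadapted]

theorem apply_eq_neg_apply (hM : IsAlmostParaquaternionicHermitian g σ) {p : M}
    {T : TangentSpace 𝓘(ℝ, E) p →L[ℝ] TangentSpace 𝓘(ℝ, E) p} (hT : T ∈ σ p)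
    (u v : TangentSpace 𝓘(ℝ, E) p) : g p (T u) v = -g p u (T v) := by
  obtain ⟨U, J, hp, hJ⟩ := hM.almost p
  rw [← hJ.span_eq p hp] at hT
  induction hT using Submodule.span_induction with
  | mem T hT =>
    obtain ⟨α, rfl⟩ := hT
    exact hM.apply_canonicalLocalBasis hJ hp α u v
  | zero => simp only [zero_apply, map_zero, neg_zero]
  | add A B _ _ hA hB => simp only [add_apply, map_add, hA, hB, neg_add]
  | smul c A _ hA => simp only [smul_apply, map_smul, hA, smul_neg]

end IsAlmostParaquaternionicHermitian

variable [IsManifold 𝓘(ℝ, F) ∞ N]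

theorem mem_orthCompl_nuPerp_iff (hJ : IsCanonicalLocalBasis σ U J)
    (hx : f x ∈ U) {w : TangentSpace 𝓘(ℝ, E) (f x)} :
    w ∈ orthCompl (g (f x)) (nuPerp g σ f D x) ↔
      ∀ α, ∀ u ∈ distPerp g f D x,
        g (f x) (J α (f x) (mfderiv 𝓘(ℝ, F) 𝓘(ℝ, E) f x u)) w = 0 := by
  refine ⟨fun hw α u hu =>
    hw _ (apply_mfderiv_mem_nuPerp ((hJ.isLocalSection α).mem _ hx) hu), fun hw => ?_⟩
  have hle : nuPerp g σ f D x ≤ ((g (f x)).toBilinForm.flip w).ker := by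
    rw [nuPerp_eq g σ f D hJ x hx]
    refine iSup_le fun α => ?_
    rintro _ ⟨_, ⟨u, hu, rfl⟩, rfl⟩
    exact hw α u hu
  exact fun n hn => hle hn

namespace IsParaquaternionicCR

theorem exists_canonicalLocalBasis_mfderiv_eq (hN : IsParaquaternionicCR g σ f D)
    (hJ : IsCanonicalLocalBasis σ U J) (hx : f x ∈ U) (α : Fin 3) {w : TangentSpace 𝓘(ℝ, F) x}
    (hw : w ∈ D x) :
    ∃ u ∈ D x, J α (f x) (mfderiv 𝓘(ℝ, F) 𝓘(ℝ, E) f x u) = mfderiv 𝓘(ℝ, F) 𝓘(ℝ, E) f x w := by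
  have hmem : mfderiv 𝓘(ℝ, F) 𝓘(ℝ, E) f x w ∈ tangentImage f x (D x) := ⟨w, hw, rfl⟩
  rw [← hN.paraquaternionic U J hJ x hx α] at hmem
  obtain ⟨_, ⟨u, hu, rfl⟩, heq⟩ := hmem
  exact ⟨u, hu, heq⟩

theorem exists_mfderiv_eq_canonicalLocalBasis (hN : IsParaquaternionicCR g σ f D)
    (hJ : IsCanonicalLocalBasis σ U J) (hx : f x ∈ U) (α : Fin 3) {u : TangentSpace 𝓘(ℝ, F) x}
    (hu : u ∈ D x) :
    ∃ w ∈ D x, mfderiv 𝓘(ℝ, F) 𝓘(ℝ, E) f x w = J α (f x) (mfderiv 𝓘(ℝ, F) 𝓘(ℝ, E) f x u) := by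
  have hmem : J α (f x) (mfderiv 𝓘(ℝ, F) 𝓘(ℝ, E) f x u) ∈ tangentImage f x (D x) :=
    hN.paraquaternionic U J hJ x hx α ▸ Submodule.mem_map_of_mem ⟨u, hu, rfl⟩
  exact hmem

theorem nuPerp_le_normalSpace (hN : IsParaquaternionicCR g σ f D)
    (hM : IsAlmostParaquaternionicHermitian g σ) (x : N) :
    nuPerp g σ f D x ≤ normalSpace F g f x := by
  obtain ⟨U, J, hx, hJ⟩ := hM.almost (f x)
  rw [nuPerp_eq g σ f D hJ x hx]
  exact iSup_le fun α => hN.totallyReal U J hJ x hx α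

theorem apply_mfderiv_mem_normalSpace (hN : IsParaquaternionicCR g σ f D)
    (hM : IsAlmostParaquaternionicHermitian g σ)
    {T : TangentSpace 𝓘(ℝ, E) (f x) →L[ℝ] TangentSpace 𝓘(ℝ, E) (f x)} (hT : T ∈ σ (f x))
    {u : TangentSpace 𝓘(ℝ, F) x} (hu : u ∈ distPerp g f D x) :
    T (mfderiv 𝓘(ℝ, F) 𝓘(ℝ, E) f x u) ∈ normalSpace F g f x :=
  hN.nuPerp_le_normalSpace hM x (apply_mfderiv_mem_nuPerp hT hu)

theorem exists_isSectionAlong_nuPerp_eq [FiniteDimensional ℝ F] [T2Space N]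
    (hN : IsParaquaternionicCR g σ f D) (hS : IsLocalSection σ U S) (hx : f x ∈ U)
    {Z : ∀ y : N, TangentSpace 𝓘(ℝ, F) y} (hZ : IsSection (distPerp g f D) Z) :
    ∃ ξ, IsSectionAlong F f (nuPerp g σ f D) ξ ∧
      ξ x = S (f x) (mfderiv 𝓘(ℝ, F) 𝓘(ℝ, E) f x (Z x)) := by
  refine exists_isSectionAlong_eq (V := fun y => S (f y) (mfderiv 𝓘(ℝ, F) 𝓘(ℝ, E) f y (Z y)))
    hN.contMDiff (hS.isOpen.preimage hN.contMDiff.continuous) hx ?_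
    fun y hy => apply_mfderiv_mem_nuPerp (hS.mem _ hy) (hZ.2 y)
  have hfZ : ContMDiff 𝓘(ℝ, F) 𝓘(ℝ, E).tangent ∞ fun y =>
      (TotalSpace.mk' E (f y) (mfderiv 𝓘(ℝ, F) 𝓘(ℝ, E) f y (Z y)) : TangentBundle 𝓘(ℝ, E) M) :=
    (hN.contMDiff.contMDiff_tangentMap (by simp)).comp hZ.1
  exact (hS.smooth.comp hN.contMDiff.contMDiffOn subset_rfl).clm_bundle_apply hfZ.contMDiffOn

variable {X Y Z : ∀ y : N, TangentSpace 𝓘(ℝ, F) y}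

/- As `σ` is parallel, `∇̄_v (S Z) - S (∇̄_v Z)` is the value at `Z` of an element of `σ`, hence
normal. -/
theorem apply_covDerivAlong_apply_mfderiv (hN : IsParaquaternionicCR g σ f D)
    (hM : IsParaquaternionicKahler g σ) (hS : IsLocalSection σ U S) (hx : f x ∈ U)
    (hZ : IsSection (distPerp g f D) Z) (v w : TangentSpace 𝓘(ℝ, F) x) :
    g (f x) (covDerivAlong g f (fun y => S (f y) (mfderiv 𝓘(ℝ, F) 𝓘(ℝ, E) f y (Z y))) x v)
        (mfderiv 𝓘(ℝ, F) 𝓘(ℝ, E) f x w)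
      = g (f x)
          (S (f x) (covDerivAlong g f (fun y => mfderiv 𝓘(ℝ, F) 𝓘(ℝ, E) f y (Z y)) x v))
          (mfderiv 𝓘(ℝ, F) 𝓘(ℝ, E) f x w) := by
  obtain ⟨T, hT, hST⟩ := hM.exists_covDerivEnd_eq hS hx (mfderiv 𝓘(ℝ, F) 𝓘(ℝ, E) f x v)
  rw [hS.smooth.covDerivAlong_apply hS.isOpen hx
      ((hZ.mdifferentiableAlongAt x).mfderiv_apply hN.contMDiff), hST, map_add, add_apply,
    hM.metric.apply_mfderiv_of_mem_normalSpace
      (hN.apply_mfderiv_mem_normalSpace hM.toIsAlmostParaquaternionicHermitian hT (hZ.2 x)),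
    zero_add]

variable [FiniteDimensional ℝ E]

theorem apply_covDerivAlong_mfderiv_apply (hN : IsParaquaternionicCR g σ f D)
    (hM : IsParaquaternionicKahler g σ) (hS : IsLocalSection σ U S) (hx : f x ∈ U)
    (hZ : IsSection (distPerp g f D) Z)
    (hY : MDifferentiableAlongAt F (fun y : N => y) Y x) (v : TangentSpace 𝓘(ℝ, F) x) :
    g (f x) (S (f x) (mfderiv 𝓘(ℝ, F) 𝓘(ℝ, E) f x (Z x)))
        (covDerivAlong g f (fun y => mfderiv 𝓘(ℝ, F) 𝓘(ℝ, E) f y (Y y)) x v)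
      = g (f x) (covDerivAlong g f (fun y => mfderiv 𝓘(ℝ, F) 𝓘(ℝ, E) f y (Z y)) x v)
          (S (f x) (mfderiv 𝓘(ℝ, F) 𝓘(ℝ, E) f x (Y x))) := by
  have hSZ : ∀ᶠ y in 𝓝 x, g (f y) (S (f y) (mfderiv 𝓘(ℝ, F) 𝓘(ℝ, E) f y (Z y)))
      (mfderiv 𝓘(ℝ, F) 𝓘(ℝ, E) f y (Y y)) = 0 := by
    filter_upwards [hN.contMDiff.continuous.continuousAt.eventually_mem
      (hS.isOpen.mem_nhds hx)] with y hy
    exact hM.metric.apply_mfderiv_of_mem_normalSpace (hN.apply_mfderiv_mem_normalSpace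
      hM.toIsAlmostParaquaternionicHermitian (hS.mem _ hy) (hZ.2 y)) (Y y)
  have hfZ := (hZ.mdifferentiableAlongAt x).mfderiv_apply hN.contMDiff
  have hderiv := hM.metric.covDerivAlong_orthogonal
    (hS.smooth.mdifferentiableAlongAt_apply hS.isOpen hx hfZ) (hY.mfderiv_apply hN.contMDiff) hSZ v
  rw [hN.apply_covDerivAlong_apply_mfderiv hM hS hx hZ,
    hM.apply_eq_neg_apply (hS.mem _ hx), neg_inj] at hderiv
  exact hderiv.symm

theorem apply_secondFundamentalForm (hN : IsParaquaternionicCR g σ f D)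
    (hM : IsParaquaternionicKahler g σ) (hS : IsLocalSection σ U S) (hx : f x ∈ U)
    (hZ : IsSection (distPerp g f D) Z)
    (hY : MDifferentiableAlongAt F (fun y : N => y) Y x) :
    g (f x) (S (f x) (mfderiv 𝓘(ℝ, F) 𝓘(ℝ, E) f x (Z x))) (secondFundamentalForm g f X Y x)
      = g (f x) (covDerivAlong g f (fun y => mfderiv 𝓘(ℝ, F) 𝓘(ℝ, E) f y (Z y)) x (X x))
          (S (f x) (mfderiv 𝓘(ℝ, F) 𝓘(ℝ, E) f x (Y x))) := by
  rw [hM.metric.apply_secondFundamentalForm (hN.apply_mfderiv_mem_normalSpace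
    hM.toIsAlmostParaquaternionicHermitian (hS.mem _ hx) (hZ.2 x)),
    hN.apply_covDerivAlong_mfderiv_apply hM hS hx hZ hY]

variable [FiniteDimensional ℝ F]

theorem apply_secondFundamentalForm_comm (hN : IsParaquaternionicCR g σ f D)
    (hM : IsParaquaternionicKahler g σ) (hS : IsLocalSection σ U S) (hx : f x ∈ U)
    (hX : IsSection (distPerp g f D) X) (hZ : IsSection (distPerp g f D) Z)
    (hY : MDifferentiableAlongAt F (fun y : N => y) Y x) :
    g (f x) (S (f x) (mfderiv 𝓘(ℝ, F) 𝓘(ℝ, E) f x (Z x))) (secondFundamentalForm g f X Y x)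
      = g (f x) (S (f x) (mfderiv 𝓘(ℝ, F) 𝓘(ℝ, E) f x (X x)))
          (secondFundamentalForm g f Z Y x) := by
  rw [hN.secondFundamentalForm_symm hM.metric (hX.mdifferentiableAlongAt x) hY,
    hN.secondFundamentalForm_symm hM.metric (hZ.mdifferentiableAlongAt x) hY,
    hN.apply_secondFundamentalForm hM hS hx hZ (hX.mdifferentiableAlongAt x), hM.metric.symm,
    hM.metric.apply_secondFundamentalForm (hN.apply_mfderiv_mem_normalSpace
      hM.toIsAlmostParaquaternionicHermitian (hS.mem _ hx) (hX.2 x))]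

end IsParaquaternionicCR

end CRSubmanifolds

section CanonicalFoliation

variable {E : Type*} [NormedAddCommGroup E] [NormedSpace ℝ E]
  {M : Type*} [TopologicalSpace M] [ChartedSpace E M] [IsManifold 𝓘(ℝ, E) ∞ M]
  {F : Type*} [NormedAddCommGroup F] [NormedSpace ℝ F]
  {N : Type*} [TopologicalSpace N] [ChartedSpace F N] [IsManifold 𝓘(ℝ, F) ∞ N]
  {g : ∀ p : M, TangentSpace 𝓘(ℝ, E) p →L[ℝ] TangentSpace 𝓘(ℝ, E) p →L[ℝ] ℝ}
  {σ : ∀ p : M, Submodule ℝ (TangentSpace 𝓘(ℝ, E) p →L[ℝ] TangentSpace 𝓘(ℝ, E) p)}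
  {f : N → M} {D : ∀ x : N, Submodule ℝ (TangentSpace 𝓘(ℝ, F) x)} {x : N}
  {X Y : ∀ y : N, TangentSpace 𝓘(ℝ, F) y}

variable (g σ f D) in
/-- The mixed part of the second fundamental form takes values in `ν`: condition (ii), to which
the other characterizations of totally geodesic `𝔉^⊥` are compared. -/
def IsMixedNuValued : Prop :=
  ∀ X Y : ∀ x : N, TangentSpace 𝓘(ℝ, F) x, IsSection D X → IsSection (distPerp g f D) Y →
    ∀ x, secondFundamentalForm g f X Y x ∈ nu g σ f D x

theorem IsMixedGeodesic.isMixedNuValued (h : IsMixedGeodesic g f D) : IsMixedNuValued g σ f D :=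
  fun X Y hX hY x => (h X Y hX hY x).symm ▸ zero_mem _

theorem isMixedNuValued_iff_isMixedGeodesic (hnu : ∀ x, nu g σ f D x = ⊥) :
    IsMixedNuValued g σ f D ↔ IsMixedGeodesic g f D :=
  forall₅_congr fun X Y _ _ x => by rw [hnu x, Submodule.mem_bot]

variable [FiniteDimensional ℝ F]

theorem IsSmoothDistribution.mem_orthCompl_iff [T2Space N] {k : ℕ} (hD : IsSmoothDistribution k D)
    (b : TangentSpace 𝓘(ℝ, F) x →L[ℝ] TangentSpace 𝓘(ℝ, F) x →L[ℝ] ℝ)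
    {u : TangentSpace 𝓘(ℝ, F) x} :
    u ∈ orthCompl b (D x) ↔ ∀ X, IsSection D X → b (X x) u = 0 := by
  refine ⟨fun hu X hX => hu _ (hX.2 x), fun hu w hw => ?_⟩
  obtain ⟨X, hX, rfl⟩ := hD.exists_isSection_eq hw
  exact hu X hX

namespace IsParaquaternionicCR

theorem exists_isSmoothDistribution_distPerp (hN : IsParaquaternionicCR g σ f D)
    (hg : IsSemiRiemannianMetric g) : ∃ k, IsSmoothDistribution k (distPerp g f D) := by
  obtain ⟨k, hk⟩ := hN.distribution
  exact ⟨_, (hN.isSemiRiemannianMetric_inducedMetric hg).isSmoothDistribution_orthCompl hk⟩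

theorem orthCompl_distPerp (hN : IsParaquaternionicCR g σ f D) (hg : IsSemiRiemannianMetric g)
    (x : N) : orthCompl (inducedMetric F g f x) (distPerp g f D x) = D x := by
  have : FiniteDimensional ℝ (TangentSpace 𝓘(ℝ, F) x) := ‹FiniteDimensional ℝ F›
  have hh := hN.isSemiRiemannianMetric_inducedMetric hg
  exact orthCompl_orthCompl (hh.symm x) (hh.nondegenerate x) (D x)

theorem inducedMetric_shapeOperator_nuPerp [FiniteDimensional ℝ E]
    (hN : IsParaquaternionicCR g σ f D) (hM : IsAlmostParaquaternionicHermitian g σ)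
    {ξ : ∀ y : N, TangentSpace 𝓘(ℝ, E) (f y)}
    (hξ : IsSectionAlong F f (nuPerp g σ f D) ξ)
    (hY : MDifferentiableAlongAt F (fun y : N => y) Y x) :
    inducedMetric F g f x (shapeOperator g f ξ X x) (Y x)
      = g (f x) (ξ x) (secondFundamentalForm g f X Y x) :=
  hN.inducedMetric_shapeOperator hM.metric ((hξ.1 x).mdifferentiableAt (by simp))
    (fun y => hN.nuPerp_le_normalSpace hM y (hξ.2 y)) hY

theorem inducedMetric_leviCivita_eq_apply_secondFundamentalForm [FiniteDimensional ℝ E]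
    (hN : IsParaquaternionicCR g σ f D) (hM : IsParaquaternionicKahler g σ) {U : Set M}
    {S : ∀ p : M, TangentSpace 𝓘(ℝ, E) p →L[ℝ] TangentSpace 𝓘(ℝ, E) p}
    (hS : IsLocalSection σ U S) (hx : f x ∈ U) {Z : ∀ y : N, TangentSpace 𝓘(ℝ, F) y}
    (hX : IsSection D X) (hY : IsSection (distPerp g f D) Y) (hZ : IsSection (distPerp g f D) Z)
    {w : TangentSpace 𝓘(ℝ, F) x}
    (hw : S (f x) (mfderiv 𝓘(ℝ, F) 𝓘(ℝ, E) f x (X x)) = mfderiv 𝓘(ℝ, F) 𝓘(ℝ, E) f x w) :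
    inducedMetric F g f x (leviCivita (inducedMetric F g f) Z x (Y x)) w
      = g (f x) (S (f x) (mfderiv 𝓘(ℝ, F) 𝓘(ℝ, E) f x (Z x)))
          (secondFundamentalForm g f X Y x) := by
  rw [hN.inducedMetric_leviCivita hM.metric (hZ.mdifferentiableAlongAt x), ← hw,
    hN.secondFundamentalForm_symm hM.metric (hX.mdifferentiableAlongAt x)
      (hY.mdifferentiableAlongAt x),
    hN.apply_secondFundamentalForm hM hS hx hZ (hX.mdifferentiableAlongAt x)]

variable [T2Space N]

theorem mem_distPerp_iff (hN : IsParaquaternionicCR g σ f D) (hg : IsSemiRiemannianMetric g)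
    {u : TangentSpace 𝓘(ℝ, F) x} :
    u ∈ distPerp g f D x ↔ ∀ X, IsSection D X → inducedMetric F g f x u (X x) = 0 := by
  obtain ⟨k, hk⟩ := hN.distribution
  simp only [(hN.isSemiRiemannianMetric_inducedMetric hg).symm x u]
  exact hk.mem_orthCompl_iff _

theorem mem_distribution_iff (hN : IsParaquaternionicCR g σ f D) (hg : IsSemiRiemannianMetric g)
    {u : TangentSpace 𝓘(ℝ, F) x} :
    u ∈ D x ↔ ∀ Y, IsSection (distPerp g f D) Y → inducedMetric F g f x u (Y x) = 0 := by
  obtain ⟨k, hk⟩ := hN.exists_isSmoothDistribution_distPerp hg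
  simp only [(hN.isSemiRiemannianMetric_inducedMetric hg).symm x u]
  rw [← hN.orthCompl_distPerp hg x]
  exact hk.mem_orthCompl_iff _

theorem secondFundamentalForm_mem_nu_iff (hN : IsParaquaternionicCR g σ f D)
    (hg : IsSemiRiemannianMetric g) {U : Set M}
    {J : Fin 3 → ∀ p : M, TangentSpace 𝓘(ℝ, E) p →L[ℝ] TangentSpace 𝓘(ℝ, E) p}
    (hJ : IsCanonicalLocalBasis σ U J) (hx : f x ∈ U) :
    secondFundamentalForm g f X Y x ∈ nu g σ f D x ↔
      ∀ α Z, IsSection (distPerp g f D) Z →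
        g (f x) (J α (f x) (mfderiv 𝓘(ℝ, F) 𝓘(ℝ, E) f x (Z x)))
          (secondFundamentalForm g f X Y x) = 0 := by
  obtain ⟨k, hk⟩ := hN.exists_isSmoothDistribution_distPerp hg
  refine ⟨fun h α Z hZ => (mem_orthCompl_nuPerp_iff hJ hx).1 h.2 α _ (hZ.2 x), fun h =>
    ⟨hN.normalPart_mem hg _, (mem_orthCompl_nuPerp_iff hJ hx).2 fun α u hu => ?_⟩⟩
  obtain ⟨Z, hZ, rfl⟩ := hk.exists_isSection_eq hu
  exact h α Z hZ

theorem isMixedNuValued_iff_forall_isSectionAlong (hN : IsParaquaternionicCR g σ f D)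
    (hM : IsAlmostParaquaternionicHermitian g σ) :
    IsMixedNuValued g σ f D ↔
      ∀ X Y ξ, IsSection D X → IsSection (distPerp g f D) Y →
        IsSectionAlong F f (nuPerp g σ f D) ξ →
        ∀ x, g (f x) (ξ x) (secondFundamentalForm g f X Y x) = 0 := by
  refine ⟨fun h X Y ξ hX hY hξ x => (h X Y hX hY x).2 _ (hξ.2 x), fun h X Y hX hY x => ?_⟩
  obtain ⟨U, J, hx, hJ⟩ := hM.almost (f x)
  refine (hN.secondFundamentalForm_mem_nu_iff hM.metric hJ hx).2 fun α Z hZ => ?_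
  obtain ⟨ξ, hξ, hξx⟩ := hN.exists_isSectionAlong_nuPerp_eq (hJ.isLocalSection α) hx hZ
  rw [← hξx]
  exact h X Y ξ hX hY hξ x

variable [FiniteDimensional ℝ E]

theorem isMixedNuValued_iff_shapeOperator_mem_distPerp (hN : IsParaquaternionicCR g σ f D)
    (hM : IsAlmostParaquaternionicHermitian g σ) :
    IsMixedNuValued g σ f D ↔
      ∀ (ξ : ∀ x : N, TangentSpace 𝓘(ℝ, E) (f x)) (X : ∀ x : N, TangentSpace 𝓘(ℝ, F) x),
        IsSectionAlong F f (nuPerp g σ f D) ξ → IsSection (distPerp g f D) X →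
        ∀ x, shapeOperator g f ξ X x ∈ distPerp g f D x := by
  have hshape {ξ X Y} (hξ : IsSectionAlong F f (nuPerp g σ f D) ξ) (hX : IsSection D X)
      (hY : IsSection (distPerp g f D) Y) (x : N) :
      inducedMetric F g f x (shapeOperator g f ξ Y x) (X x)
        = g (f x) (ξ x) (secondFundamentalForm g f X Y x) := by
    rw [hN.inducedMetric_shapeOperator_nuPerp hM hξ (hX.mdifferentiableAlongAt x),
      hN.secondFundamentalForm_symm hM.metric (hY.mdifferentiableAlongAt x)
        (hX.mdifferentiableAlongAt x)]
  rw [hN.isMixedNuValued_iff_forall_isSectionAlong hM]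
  refine ⟨fun h ξ Y hξ hY x => (hN.mem_distPerp_iff hM.metric).2 fun X hX => ?_,
    fun h X Y ξ hX hY hξ x => ?_⟩
  · rw [hshape hξ hX hY, h X Y ξ hX hY hξ]
  · rw [← hshape hξ hX hY, (hN.mem_distPerp_iff hM.metric).1 (h ξ Y hξ hY x) X hX]

theorem isMixedNuValued_iff_shapeOperator_mem_distribution (hN : IsParaquaternionicCR g σ f D)
    (hM : IsAlmostParaquaternionicHermitian g σ) :
    IsMixedNuValued g σ f D ↔
      ∀ (ξ : ∀ x : N, TangentSpace 𝓘(ℝ, E) (f x)) (Y : ∀ x : N, TangentSpace 𝓘(ℝ, F) x),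
        IsSectionAlong F f (nuPerp g σ f D) ξ → IsSection D Y →
        ∀ x, shapeOperator g f ξ Y x ∈ D x := by
  rw [hN.isMixedNuValued_iff_forall_isSectionAlong hM]
  refine ⟨fun h ξ X hξ hX x => (hN.mem_distribution_iff hM.metric).2 fun Y hY => ?_,
    fun h X Y ξ hX hY hξ x => ?_⟩
  · rw [hN.inducedMetric_shapeOperator_nuPerp hM hξ (hY.mdifferentiableAlongAt x),
      h X Y ξ hX hY hξ]
  · rw [← hN.inducedMetric_shapeOperator_nuPerp hM hξ (hY.mdifferentiableAlongAt x),
      (hN.mem_distribution_iff hM.metric).1 (h ξ X hξ hX x) Y hY]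

theorem isFoliation_distPerp (hN : IsParaquaternionicCR g σ f D)
    (hM : IsParaquaternionicKahler g σ) : IsFoliation (distPerp g f D) := by
  refine ⟨hN.exists_isSmoothDistribution_distPerp hM.metric, fun X Z hX hZ x w hw => ?_⟩
  obtain ⟨k, hk⟩ := hN.distribution
  obtain ⟨U, J, hx, hJ⟩ := hM.almost (f x)
  have hS := hJ.isLocalSection 0
  obtain ⟨u, hu, huw⟩ := hN.exists_canonicalLocalBasis_mfderiv_eq hJ hx 0 hw
  obtain ⟨Y, hY, rfl⟩ := hk.exists_isSection_eq hu
  have hY' := hY.mdifferentiableAlongAt x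
  rw [inducedMetric_apply, ← huw, hM.metric.symm, ← hM.metric.covDerivAlong_mfderiv_sub
      hN.contMDiff (hX.mdifferentiableAlongAt x) (hZ.mdifferentiableAlongAt x), map_sub, sub_apply,
    ← hN.apply_secondFundamentalForm hM hS hx hZ hY',
    ← hN.apply_secondFundamentalForm hM hS hx hX hY',
    hN.apply_secondFundamentalForm_comm hM hS hx hX hZ hY', sub_self]

theorem isTotallyGeodesicFoliation_iff_isMixedNuValued (hN : IsParaquaternionicCR g σ f D)
    (hM : IsParaquaternionicKahler g σ) :
    IsTotallyGeodesicFoliation (inducedMetric F g f) (distPerp g f D) ↔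
      IsMixedNuValued g σ f D := by
  have hh := hN.isSemiRiemannianMetric_inducedMetric hM.metric
  refine ⟨fun h X Y hX hY x => ?_, fun h =>
    ⟨hN.isFoliation_distPerp hM, fun Y Z hY hZ x w hw => ?_⟩⟩ <;>
    obtain ⟨U, J, hx, hJ⟩ := hM.almost (f x)
  · refine (hN.secondFundamentalForm_mem_nu_iff hM.metric hJ hx).2 fun α Z hZ => ?_
    obtain ⟨w, hw, hwX⟩ := hN.exists_mfderiv_eq_canonicalLocalBasis hJ hx α (hX.2 x)
    rw [← hN.inducedMetric_leviCivita_eq_apply_secondFundamentalForm hM (hJ.isLocalSection α) hx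
      hX hY hZ hwX.symm, hh.symm]
    exact h.2 Y Z hY hZ x w hw
  · obtain ⟨k, hk⟩ := hN.distribution
    obtain ⟨u, hu, huw⟩ := hN.exists_canonicalLocalBasis_mfderiv_eq hJ hx 0 hw
    obtain ⟨X, hX, rfl⟩ := hk.exists_isSection_eq hu
    rw [hh.symm, hN.inducedMetric_leviCivita_eq_apply_secondFundamentalForm hM
      (hJ.isLocalSection 0) hx hX hY hZ huw]
    exact (hN.secondFundamentalForm_mem_nu_iff hM.metric hJ hx).1 (h X Y hX hY x) 0 Z hZ

end IsParaquaternionicCR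

end CanonicalFoliation

theorem mainTheorem5
    {E : Type*} [NormedAddCommGroup E] [NormedSpace ℝ E] [FiniteDimensional ℝ E]
    {M : Type*} [TopologicalSpace M] [T2Space M] [ChartedSpace E M] [IsManifold 𝓘(ℝ, E) ∞ M]
    {F : Type*} [NormedAddCommGroup F] [NormedSpace ℝ F] [FiniteDimensional ℝ F]
    {N : Type*} [TopologicalSpace N] [T2Space N] [ChartedSpace F N] [IsManifold 𝓘(ℝ, F) ∞ N]
    (g : ∀ p : M, TangentSpace 𝓘(ℝ, E) p →L[ℝ] TangentSpace 𝓘(ℝ, E) p →L[ℝ] ℝ)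
    (σ : ∀ p : M, Submodule ℝ (TangentSpace 𝓘(ℝ, E) p →L[ℝ] TangentSpace 𝓘(ℝ, E) p))
    (hM : IsParaquaternionicKahler g σ)
    (f : N → M) (D : ∀ x : N, Submodule ℝ (TangentSpace 𝓘(ℝ, F) x))
    (hN : IsParaquaternionicCR g σ f D) :
    IsFoliation (distPerp g f D) ∧
    List.TFAE [
      IsTotallyGeodesicFoliation (inducedMetric F g f) (distPerp g f D),
      ∀ X Y : ∀ x : N, TangentSpace 𝓘(ℝ, F) x,
        IsSection D X → IsSection (distPerp g f D) Y →
        ∀ x, secondFundamentalForm g f X Y x ∈ nu g σ f D x,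
      ∀ (ξ : ∀ x : N, TangentSpace 𝓘(ℝ, E) (f x)) (X : ∀ x : N, TangentSpace 𝓘(ℝ, F) x),
        IsSectionAlong F f (nuPerp g σ f D) ξ → IsSection (distPerp g f D) X →
        ∀ x, shapeOperator g f ξ X x ∈ distPerp g f D x,
      ∀ (ξ : ∀ x : N, TangentSpace 𝓘(ℝ, E) (f x)) (Y : ∀ x : N, TangentSpace 𝓘(ℝ, F) x),
        IsSectionAlong F f (nuPerp g σ f D) ξ → IsSection D Y →
        ∀ x, shapeOperator g f ξ Y x ∈ D x] ∧
    (IsMixedGeodesic g f D →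
      IsTotallyGeodesicFoliation (inducedMetric F g f) (distPerp g f D)) ∧
    ((∀ x, nu g σ f D x = ⊥) →
      (IsTotallyGeodesicFoliation (inducedMetric F g f) (distPerp g f D) ↔
        IsMixedGeodesic g f D)) := by
  have hii := hN.isTotallyGeodesicFoliation_iff_isMixedNuValued hM
  have hM' := hM.toIsAlmostParaquaternionicHermitian
  refine ⟨hN.isFoliation_distPerp hM, ?_, fun hmixed => hii.2 hmixed.isMixedNuValued,
    fun hnu => hii.trans (isMixedNuValued_iff_isMixedGeodesic hnu)⟩
  tfae_have 1 ↔ 2 := hii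
  tfae_have 2 ↔ 3 := hN.isMixedNuValued_iff_shapeOperator_mem_distPerp hM'
  tfae_have 2 ↔ 4 := hN.isMixedNuValued_iff_shapeOperator_mem_distribution hM'
  tfae_finish
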